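/- **Setting.** Let $\mathcal V$ be an $n$-fold monoidal category with products $\otimes_1,\dots,\otimes_n$, a common unit $I$ and interchangers $\eta^{ij}_{ABCD}\colon (A\otimes_j B)\otimes_i(C\otimes_j D)\to(A\otimes_i C)\otimes_j(B\otimes_i D)$ for $i<j$, subject to the internal and external unit and associativity conditions and the giant hexagon condition. (Associators and unitors may be coherent isomorphisms; the strict case, in which they are identities, is included. They are suppressed below.) Assume that $\mathcal V$ has coproducts and that all functors $-\otimes_i A$ and $A\otimes_i-$ preserve them, including the initial object $\emptyset$. Put $\eta^{pq}_{AIIB}\colon A\otimes_pB\to A\otimes_qB$ for $p<q$, and let it be the identity for $p=q$. A collection is a sequence $\mathcal C=(\mathcal C(j))_{j\ge0}$ of objects of $\mathcal V$. For $p<q$ set $$(\mathcal B\otimes^{pq}\mathcal C)(j)=\coprod_{k\ge 0,\ j_1+\dots+j_k=j}\mathcal B(k)\otimes_p(\mathcal C(j_1)\otimes_q\cdots\otimes_q\mathcal C(j_k)),$$ with unit $(\emptyset,I,\emptyset,\emptyset,\dots)$ and with the lax associator $(\mathcal A\otimes^{pq}\mathcal B)\otimes^{pq}\mathcal C\to\mathcal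 A\otimes^{pq}(\mathcal B\otimes^{pq}\mathcal C)$ induced by $\eta^{pq}$. Let $2\le m\le n$. *Condensed definition.* An $m$-fold operad is a monoid in $\mathrm{Col}_m(\mathcal V)$, that is, in collections with the product $\otimes^{(m-1)m}$. *Expanded definition.* An $m$-fold operad is a collection $\mathcal C$ with a unit $\mathcal J\colon I\to\mathcal C(1)$ and compositions $$\gamma^{pq}\colon \mathcal C(k)\otimes_p(\mathcal C(j_1)\otimes_q\cdots\otimes_q\mathcal C(j_k))\to\mathcal C(j_1+\dots+j_k)\qquad(1\le p<q\le m,\ k\ge1,\ j_s\ge0)$$ such that, for each pair $(p,q)$, the operad associativity diagram (whose rearrangement is built from $\eta^{pq}$) and the two unit diagrams commute; where a composition with $k=0$ occurs in these diagrams it is read as the canonical map $\mathcal C(0)\otimes_p I=\mathcal C(0)$. Call it *compatible* if for all $p<s\le q+1\le m$ $$\gamma^{ps}=\gamma^{q,q+1}\circ\bigl(\eta^{pq}_{AIIB}\circ(1\otimes_p\eta^{s,q+1})\bigr),$$ where $\eta^{s,q+1}$ is the map $\mathcal C(j_1)\otimes_s\cdots\otimes_s\mathcal C(j_k)\to\mathcal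 C(j_1)\otimes_{q+1}\cdots\otimes_{q+1}\mathcal C(j_k)$ built from the maps $\eta^{s,q+1}_{AIIB}$. **Theorem.** The two definitions are equivalent in the following sense. 1. For every expanded $m$-fold operad on $\mathcal C$ there is exactly one monoid structure on $\mathcal C$ in $\mathrm{Col}_m(\mathcal V)$ whose unit is $\mathcal J$ and whose multiplication has the components $\gamma^{m-1,m}$ (for $k\ge1$). 2. Every monoid structure on $\mathcal C$ in $\mathrm{Col}_m(\mathcal V)$ arises in this way from exactly one compatible expanded $m$-fold operad structure on $\mathcal C$. 3. Under this correspondence between compatible expanded $m$-fold operads and monoids, a map of collections commutes with the units and all $\gamma^{pq}$ if and only if it is a homomorphism of monoids. 4. For every monoid in $\mathrm{Col}_m(\mathcal V)$ with multiplication components $\gamma^{m-1,m}$ and all $1\le p<s\le m$, the same unit and the maps $\gamma^{ps}=\gamma^{m-1,m}\circ(\eta^{p,m-1}_{AIIB}\circ(1\otimes_p\eta^{s,m}))$ are the unit and the components of exactly one monoid structure on $\mathcal C$ for $\otimes^{ps}$. In particular, if $m\ge3$, every $m$-fold operad is an $(m-1)$-fold operad, with $\gamma^{m-2,m-1}$ built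 from $\gamma^{m-1,m}$ in this way. -/

import Mathlib

open CategoryTheory CategoryTheory.Limits

universe v u

/-- `n` tensor product functors on a category together with one common unit object. The products are
indexed by `Fin n`, so that the index `i` stands for the product number `i + 1`. -/
structure TensorData (n : ℕ) (V : Type u) [Category.{v} V] where
  unit : V
  tensor : Fin n → V ⥤ V ⥤ V

namespace TensorData

variable {n : ℕ} {V : Type u} [Category.{v} V] (T : TensorData n V)

/-- The product `A ⊗ᵢ B` of two objects. -/
abbrev ob (i : Fin n) (A B : V) : V := ((T.tensor i).obj A).obj B

/-- The product `f ⊗ᵢ g` of two morphisms. -/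
def hom (i : Fin n) {A A' B B' : V} (f : A ⟶ A') (g : B ⟶ B') : T.ob i A B ⟶ T.ob i A' B' :=
  ((T.tensor i).map f).app B ≫ ((T.tensor i).obj A').map g

end TensorData

/-- An `n`-fold monoidal category with a common unit `I`. Associators and unitors are part of the
structure; in the strict case they are identities (`eqToIso`), the unit conditions say that
`η_{ABII}`, `η_{IIAB}`, `η_{AIBI}` and `η_{IAIB}` are identities, and the pentagon and the triangle
hold trivially. -/
structure IteratedMonoidal (n : ℕ) (V : Type u) [Category.{v} V] extends TensorData n V where
  assoc (i : Fin n) (A B C : V) :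
    toTensorData.ob i (toTensorData.ob i A B) C ≅ toTensorData.ob i A (toTensorData.ob i B C)
  leftUnitor (i : Fin n) (A : V) : toTensorData.ob i unit A ≅ A
  rightUnitor (i : Fin n) (A : V) : toTensorData.ob i A unit ≅ A
  assoc_naturality (i : Fin n) {A A' B B' C C' : V} (f : A ⟶ A') (g : B ⟶ B') (h : C ⟶ C') :
    toTensorData.hom i (toTensorData.hom i f g) h ≫ (assoc i A' B' C').hom =
      (assoc i A B C).hom ≫ toTensorData.hom i f (toTensorData.hom i g h)
  leftUnitor_naturality (i : Fin n) {A A' : V} (f : A ⟶ A') :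
    toTensorData.hom i (𝟙 unit) f ≫ (leftUnitor i A').hom = (leftUnitor i A).hom ≫ f
  rightUnitor_naturality (i : Fin n) {A A' : V} (f : A ⟶ A') :
    toTensorData.hom i f (𝟙 unit) ≫ (rightUnitor i A').hom = (rightUnitor i A).hom ≫ f
  pentagon (i : Fin n) (U W X Y : V) :
    toTensorData.hom i (assoc i U W X).hom (𝟙 Y) ≫
        (assoc i U (toTensorData.ob i W X) Y).hom ≫
          toTensorData.hom i (𝟙 U) (assoc i W X Y).hom =
      (assoc i (toTensorData.ob i U W) X Y).hom ≫ (assoc i U W (toTensorData.ob i X Y)).hom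
  triangle (i : Fin n) (A B : V) :
    (assoc i A unit B).hom ≫ toTensorData.hom i (𝟙 A) (leftUnitor i B).hom =
      toTensorData.hom i (rightUnitor i A).hom (𝟙 B)
  /-- The interchangers `η^{ij}_{ABCD} : (A ⊗ⱼ B) ⊗ᵢ (C ⊗ⱼ D) ⟶ (A ⊗ᵢ C) ⊗ⱼ (B ⊗ᵢ D)`. -/
  eta (i j : Fin n) (hij : i < j) (A B C D : V) :
    toTensorData.ob i (toTensorData.ob j A B) (toTensorData.ob j C D) ⟶
      toTensorData.ob j (toTensorData.ob i A C) (toTensorData.ob i B D)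
  eta_naturality (i j : Fin n) (hij : i < j) {A A' B B' C C' D D' : V}
    (a : A ⟶ A') (b : B ⟶ B') (c : C ⟶ C') (d : D ⟶ D') :
    toTensorData.hom i (toTensorData.hom j a b) (toTensorData.hom j c d) ≫
        eta i j hij A' B' C' D' =
      eta i j hij A B C D ≫
        toTensorData.hom j (toTensorData.hom i a c) (toTensorData.hom i b d)
  internal_unit_right (i j : Fin n) (hij : i < j) (A B : V) :
    eta i j hij A B unit unit ≫
        toTensorData.hom j (rightUnitor i A).hom (rightUnitor i B).hom =
      toTensorData.hom i (𝟙 (toTensorData.ob j A B)) (leftUnitor j unit).hom ≫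
        (rightUnitor i (toTensorData.ob j A B)).hom
  internal_unit_left (i j : Fin n) (hij : i < j) (A B : V) :
    eta i j hij unit unit A B ≫
        toTensorData.hom j (leftUnitor i A).hom (leftUnitor i B).hom =
      toTensorData.hom i (leftUnitor j unit).hom (𝟙 (toTensorData.ob j A B)) ≫
        (leftUnitor i (toTensorData.ob j A B)).hom
  external_unit_right (i j : Fin n) (hij : i < j) (A B : V) :
    eta i j hij A unit B unit ≫
        toTensorData.hom j (𝟙 (toTensorData.ob i A B)) (leftUnitor i unit).hom ≫
          (rightUnitor j (toTensorData.ob i A B)).hom =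
      toTensorData.hom i (rightUnitor j A).hom (rightUnitor j B).hom
  external_unit_left (i j : Fin n) (hij : i < j) (A B : V) :
    eta i j hij unit A unit B ≫
        toTensorData.hom j (leftUnitor i unit).hom (𝟙 (toTensorData.ob i A B)) ≫
          (leftUnitor j (toTensorData.ob i A B)).hom =
      toTensorData.hom i (leftUnitor j A).hom (leftUnitor j B).hom
  internal_assoc (i j : Fin n) (hij : i < j) (U U' W W' Y Y' : V) :
    toTensorData.hom i (eta i j hij U U' W W') (𝟙 (toTensorData.ob j Y Y')) ≫
        eta i j hij (toTensorData.ob i U W) (toTensorData.ob i U' W') Y Y' ≫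
          toTensorData.hom j (assoc i U W Y).hom (assoc i U' W' Y').hom =
      (assoc i (toTensorData.ob j U U') (toTensorData.ob j W W') (toTensorData.ob j Y Y')).hom ≫
        toTensorData.hom i (𝟙 (toTensorData.ob j U U')) (eta i j hij W W' Y Y') ≫
          eta i j hij U U' (toTensorData.ob i W Y) (toTensorData.ob i W' Y')
  external_assoc (i j : Fin n) (hij : i < j) (U U' U'' X X' X'' : V) :
    eta i j hij (toTensorData.ob j U U') U'' (toTensorData.ob j X X') X'' ≫
        toTensorData.hom j (eta i j hij U U' X X') (𝟙 (toTensorData.ob i U'' X'')) ≫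
          (assoc j (toTensorData.ob i U X) (toTensorData.ob i U' X')
            (toTensorData.ob i U'' X'')).hom =
      toTensorData.hom i (assoc j U U' U'').hom (assoc j X X' X'').hom ≫
        eta i j hij U (toTensorData.ob j U' U'') X (toTensorData.ob j X' X'') ≫
          toTensorData.hom j (𝟙 (toTensorData.ob i U X)) (eta i j hij U' U'' X' X'')
  /-- The giant hexagon for three different products. -/
  hexagon (i j k : Fin n) (hij : i < j) (hjk : j < k) (A A' B B' C C' D D' : V) :
    toTensorData.hom i (eta j k hjk A A' B B') (eta j k hjk C C' D D') ≫
        eta i k (hij.trans hjk) (toTensorData.ob j A B) (toTensorData.ob j A' B')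
          (toTensorData.ob j C D) (toTensorData.ob j C' D') ≫
          toTensorData.hom k (eta i j hij A B C D) (eta i j hij A' B' C' D') =
      eta i j hij (toTensorData.ob k A A') (toTensorData.ob k B B')
          (toTensorData.ob k C C') (toTensorData.ob k D D') ≫
        toTensorData.hom j (eta i k (hij.trans hjk) A A' C C')
            (eta i k (hij.trans hjk) B B' D D') ≫
          eta j k hjk (toTensorData.ob i A C) (toTensorData.ob i A' C')
            (toTensorData.ob i B D) (toTensorData.ob i B' D')

namespace IteratedMonoidal

variable {n : ℕ} {V : Type u} [Category.{v} V] (M : IteratedMonoidal n V)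

/-- All the functors `- ⊗ᵢ A` and `A ⊗ᵢ -` preserve (set-indexed) coproducts, among them the empty
one, the initial object. -/
structure PreservesCoproducts : Prop where
  left (i : Fin n) (A : V) (J : Type) :
    PreservesColimitsOfShape (Discrete J) ((M.tensor i).flip.obj A)
  right (i : Fin n) (A : V) (J : Type) :
    PreservesColimitsOfShape (Discrete J) ((M.tensor i).obj A)

/-! ### Iterated products and the interchangers between them -/

/-- `f b₁ ⊗_q (f b₂ ⊗_q (⋯ ⊗_q (f b_k ⊗_q I)))` for a list `[b₁, …, b_k]`. -/
def iter (q : Fin n) {β : Type} (f : β → V) : List β → V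
  | [] => M.unit
  | b :: l => M.ob q (f b) (iter q f l)

/-- The product of a family of morphisms over a list. -/
def iterMap (q : Fin n) {β : Type} {f g : β → V} (φ : ∀ b, f b ⟶ g b) :
    ∀ l : List β, M.iter q f l ⟶ M.iter q g l
  | [] => 𝟙 _
  | b :: l => M.hom q (φ b) (iterMap q φ l)

/-- The product of a family of morphisms over a list, the target being reindexed along `r`. -/
def iterMapTo (q : Fin n) {β β' : Type} {f : β → V} {g : β' → V} (r : β → β')
    (φ : ∀ b, f b ⟶ g (r b)) : ∀ l : List β, M.iter q f l ⟶ M.iter q g (l.map r)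
  | [] => 𝟙 _
  | b :: l => M.hom q (φ b) (iterMapTo q r φ l)

/-- The canonical rebracketing of a product over a concatenated list (an identity in the strict
case). -/
def iterAppend (q : Fin n) {β : Type} (f : β → V) :
    ∀ l l' : List β, M.iter q f (l ++ l') ⟶ M.ob q (M.iter q f l) (M.iter q f l')
  | [], l' => (M.leftUnitor q (M.iter q f l')).inv
  | b :: l, l' => M.hom q (𝟙 (f b)) (iterAppend q f l l') ≫
      (M.assoc q (f b) (M.iter q f l) (M.iter q f l')).inv

/-- The map `(⨂_q C(j_s)) ⊗_p (⨂_q D(i_t)) ⟶ ⨂_q (C(j_s) ⊗_p ⨂_q D(i_{u + g_{s-1}}))` made of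
instances of `η^{pq}`. The `s`-th member of the list `L` is the `s`-th block of the sequence of the
`i_t`, its length is `j_s`, and the sequence of the `i_t` is the concatenation of the blocks. -/
def iterEta (p q : Fin n) (hpq : p < q) (C D : ℕ → V) :
    ∀ L : List (List ℕ),
      M.ob p (M.iter q C (L.map List.length)) (M.iter q D L.flatten) ⟶
        M.iter q (fun l => M.ob p (C l.length) (M.iter q D l)) L
  | [] => (M.leftUnitor p M.unit).hom
  | l :: L =>
      M.hom p (𝟙 (M.ob q (C l.length) (M.iter q C (L.map List.length))))
          (M.iterAppend q D l L.flatten) ≫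
        M.eta p q hpq (C l.length) (M.iter q C (L.map List.length))
          (M.iter q D l) (M.iter q D L.flatten) ≫
        M.hom q (𝟙 (M.ob p (C l.length) (M.iter q D l))) (iterEta p q hpq C D L)

/-- `⨂_q^k J : I = ⨂_q^k I ⟶ ⨂_q^k C(1)`. -/
def iterUnit (q : Fin n) {C : ℕ → V} (J : M.unit ⟶ C 1) :
    ∀ k : ℕ, M.unit ⟶ M.iter q C (List.replicate k 1)
  | 0 => 𝟙 _
  | k + 1 => (M.leftUnitor q M.unit).inv ≫ M.hom q J (iterUnit q J k)

/-- `η^{pq}_{AIIB} : A ⊗_p B ⟶ A ⊗_q B` for `p < q`, and the identity for `p = q`. -/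
def change (p q : Fin n) (hpq : p ≤ q) (A B : V) : M.ob p A B ⟶ M.ob q A B :=
  if h : p < q then
    M.hom p (M.rightUnitor q A).inv (M.leftUnitor q B).inv ≫
      M.eta p q h A M.unit M.unit B ≫
      M.hom q (M.rightUnitor p A).hom (M.leftUnitor p B).hom
  else eqToHom (by rw [le_antisymm hpq (not_lt.mp h)])

/-- The map `⨂_s f(b) ⟶ ⨂_r f(b)` made of the maps `η^{sr}_{AIIB}`. -/
def iterChange (s r : Fin n) (hsr : s ≤ r) {β : Type} (f : β → V) :
    ∀ l : List β, M.iter s f l ⟶ M.iter r f l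
  | [] => 𝟙 _
  | b :: l => M.hom s (𝟙 (f b)) (iterChange s r hsr f l) ≫ M.change s r hsr (f b) (M.iter r f l)

/-- The map `A ⊗_p (⨂_s C(j_t)) ⟶ A ⊗_q (⨂_r C(j_t))`: first `1 ⊗_p η^{sr}`, then `η^{pq}`. -/
def domainChange (p s q r : Fin n) (hpq : p ≤ q) (hsr : s ≤ r) (A : V) (C : ℕ → V) (l : List ℕ) :
    M.ob p A (M.iter s C l) ⟶ M.ob q A (M.iter r C l) :=
  M.hom p (𝟙 A) (M.iterChange s r hsr C l) ≫ M.change p q hpq A (M.iter r C l)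

/-! ### The expanded definition of an `m`-fold operad -/

/-- The data of an `m`-fold operad on the collection `C`: a unit and, for all `p < q` among the first
`m` products, compositions `γ^{pq} : C(k) ⊗_p (C(j₁) ⊗_q ⋯ ⊗_q C(j_k)) ⟶ C(j)` with `k ≥ 1` and
`j = j₁ + ⋯ + j_k`; here `l = [j₁, …, j_k]`. -/
structure OperadData (m : ℕ) (C : ℕ → V) where
  unit : M.unit ⟶ C 1
  comp (p q : Fin n) (hpq : p < q) (hq : q.val < m) {k j : ℕ} (l : List ℕ) (hpos : 1 ≤ k)
    (hk : l.length = k) (hj : l.sum = j) : M.ob p (C k) (M.iter q C l) ⟶ C j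

namespace OperadData

variable {M} {m : ℕ} {C : ℕ → V}

/-- The composition `γ^{pq}`, extended to `k = 0` by the canonical map `C(0) ⊗_p I ⟶ C(0)`
(the identity of `C(0)` in the strict case). It occurs in the associativity axiom when some `j_s` or
their sum is zero. -/
def gam (O : M.OperadData m C) (p q : Fin n) (hpq : p < q) (hq : q.val < m) {k j : ℕ} :
    ∀ (l : List ℕ), l.length = k → l.sum = j → (M.ob p (C k) (M.iter q C l) ⟶ C j)
  | [], hk, hj => (M.rightUnitor p (C k)).hom ≫ eqToHom (congrArg C (hk.symm.trans hj))
  | a :: l, hk, hj =>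
      O.comp p q hpq hq (a :: l) (hk ▸ Nat.le_add_left 1 l.length) hk hj

end OperadData

/-- An `m`-fold operad structure on the collection `C`, in expanded form. -/
structure ExpandedOperad (m : ℕ) (C : ℕ → V) extends M.OperadData m C where
  /-- In the notation of `iterEta`: `L` has `k` members, `j` is the sum of their lengths `j_s`,
  `i` is the sum of all their entries, and `h_s` is the sum of the entries of the `s`-th member. -/
  associativity (p q : Fin n) (hpq : p < q) (hq : q.val < m) {k j i : ℕ} (L : List (List ℕ))
    (_hpos : 1 ≤ k) (hk : L.length = k) (hj : L.flatten.length = j) (hi : L.flatten.sum = i) :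
    M.hom p (toOperadData.gam p q hpq hq (L.map List.length) ((List.length_map _).trans hk)
        (List.length_flatten.symm.trans hj)) (𝟙 (M.iter q C L.flatten)) ≫
      toOperadData.gam p q hpq hq L.flatten hj hi =
    (M.assoc p (C k) (M.iter q C (L.map List.length)) (M.iter q C L.flatten)).hom ≫
      M.hom p (𝟙 (C k)) (M.iterEta p q hpq C C L) ≫
      M.hom p (𝟙 (C k)) (M.iterMapTo q List.sum
        (fun l => toOperadData.gam p q hpq hq l rfl rfl) L) ≫
      toOperadData.gam p q hpq hq (L.map List.sum) ((List.length_map _).trans hk)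
        (List.sum_flatten.symm.trans hi)
  unit_right (p q : Fin n) (hpq : p < q) (hq : q.val < m) (k : ℕ) :
    (M.rightUnitor p (C k)).inv ≫ M.hom p (𝟙 (C k)) (M.iterUnit q toOperadData.unit k) ≫
      toOperadData.gam p q hpq hq (List.replicate k 1) List.length_replicate (by simp) = 𝟙 (C k)
  unit_left (p q : Fin n) (hpq : p < q) (hq : q.val < m) (k : ℕ) :
    (M.leftUnitor p (C k)).inv ≫ M.hom p toOperadData.unit (M.rightUnitor q (C k)).inv ≫
      toOperadData.gam p q hpq hq [k] rfl (by simp) = 𝟙 (C k)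

namespace ExpandedOperad

variable {M} {m : ℕ} {C D : ℕ → V}

/-- The compositions are compatible with the interchangers: for `p < s ≤ q + 1 ≤ m`,
`γ^{ps} = γ^{q,q+1} ∘ (η^{pq} ∘ (1 ⊗ η^{s,q+1}))`. -/
def Compatible (O : M.ExpandedOperad m C) : Prop :=
  ∀ (p s q r : Fin n) (hps : p < s) (hsr : s ≤ r) (hqr : q.val + 1 = r.val) (hr : r.val < m)
    (k j : ℕ) (l : List ℕ) (hpos : 1 ≤ k) (hk : l.length = k) (hj : l.sum = j),
    O.comp p s hps (lt_of_le_of_lt hsr hr) l hpos hk hj =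
      M.domainChange p s q r (by omega) hsr (C k) C l ≫
        O.comp q r (by omega) hr l hpos hk hj

/-- Morphisms of collections that commute with the units and with all the compositions. -/
structure IsHom (O : M.ExpandedOperad m C) (O' : M.ExpandedOperad m D) (f : ∀ j, C j ⟶ D j) :
    Prop where
  unit : O.unit ≫ f 1 = O'.unit
  comp (p q : Fin n) (hpq : p < q) (hq : q.val < m) (k j : ℕ) (l : List ℕ) (hpos : 1 ≤ k)
    (hk : l.length = k) (hj : l.sum = j) :
    O.comp p q hpq hq l hpos hk hj ≫ f j =
      M.hom p (f k) (M.iterMap q f l) ≫ O'.comp p q hpq hq l hpos hk hj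

end ExpandedOperad

/-! ### Collections and the product `⊗^{pq}` of collections -/

/-- For a functor `- ⊗_p Y` that preserves coproducts, a map out of `(∐ X) ⊗_p Y` is a family of maps
out of the `X b ⊗_p Y`. -/
noncomputable def descLeft [HasCoproducts.{0} V] (hM : M.PreservesCoproducts) (p : Fin n)
    {J : Type} (X : J → V) (Y : V) {Z : V} (φ : ∀ b, M.ob p (X b) Y ⟶ Z) :
    M.ob p (∐ X) Y ⟶ Z :=
  haveI := hM.left p Y J
  Cofan.IsColimit.desc
    (isColimitOfHasCoproductOfPreservesColimit ((M.tensor p).flip.obj Y) X) φ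

/-- `(B ⊗^{pq} C)(j) = ∐ B(k) ⊗_p (C(j₁) ⊗_q ⋯ ⊗_q C(j_k))` over all `k ≥ 0` and all
`j₁ + ⋯ + j_k = j`. -/
noncomputable def colTensor [HasCoproducts.{0} V] (p q : Fin n) (B C : ℕ → V) : ℕ → V := fun j =>
  ∐ fun l : {l : List ℕ // l.sum = j} => M.ob p (B l.1.length) (M.iter q C l.1)

/-- The inclusion of the summand of `(B ⊗^{pq} C)(j)` that belongs to `l = [j₁, …, j_k]`. -/
noncomputable def colι [HasCoproducts.{0} V] (p q : Fin n) (B C : ℕ → V) {k j : ℕ} (l : List ℕ)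
    (hk : l.length = k) (hj : l.sum = j) :
    M.ob p (B k) (M.iter q C l) ⟶ M.colTensor p q B C j :=
  eqToHom (by rw [hk]) ≫
    Sigma.ι (fun l : {l : List ℕ // l.sum = j} => M.ob p (B l.1.length) (M.iter q C l.1)) ⟨l, hj⟩

/-- The product `⊗^{pq}` of morphisms of collections. -/
noncomputable def colTensorHom [HasCoproducts.{0} V] (p q : Fin n) {B B' C C' : ℕ → V}
    (f : ∀ j, B j ⟶ B' j) (g : ∀ j, C j ⟶ C' j) (j : ℕ) :
    M.colTensor p q B C j ⟶ M.colTensor p q B' C' j :=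
  Limits.Sigma.map fun l => M.hom p (f l.1.length) (M.iterMap q g l.1)

/-- The lax associator `(B ⊗^{pq} C) ⊗^{pq} D ⟶ B ⊗^{pq} (C ⊗^{pq} D)` on the term that belongs to the
list of blocks `L`: reassociate, interchange by `η^{pq}`, and include. -/
noncomputable def colAssocTerm [HasCoproducts.{0} V] (p q : Fin n) (hpq : p < q) (B C D : ℕ → V)
    {i : ℕ} (L : List (List ℕ)) (hi : L.flatten.sum = i) :
    M.ob p (M.ob p (B (L.map List.length).length) (M.iter q C (L.map List.length)))
        (M.iter q D L.flatten) ⟶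
      M.colTensor p q B (M.colTensor p q C D) i :=
  (M.assoc p _ _ _).hom ≫
    M.hom p (𝟙 _) (M.iterEta p q hpq C D L) ≫
    M.hom p (𝟙 _) (M.iterMapTo q (g := M.colTensor p q C D) List.sum
      (fun l => M.colι p q C D l rfl rfl) L) ≫
    M.colι p q B (M.colTensor p q C D) (L.map List.sum) (by simp) (List.sum_flatten.symm.trans hi)

/-- The lax associator `(B ⊗^{pq} C) ⊗^{pq} D ⟶ B ⊗^{pq} (C ⊗^{pq} D)`. The term of the source that
belongs to `l = [i₁, …, i_j]` and `l' = [j₁, …, j_k]` is the one treated above, for the decomposition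
of `l` into blocks of the lengths `j₁, …, j_k`. -/
noncomputable def colAssoc [HasCoproducts.{0} V] (hM : M.PreservesCoproducts) (p q : Fin n)
    (hpq : p < q) (B C D : ℕ → V) (i : ℕ) :
    M.colTensor p q (M.colTensor p q B C) D i ⟶ M.colTensor p q B (M.colTensor p q C D) i :=
  Sigma.desc fun l => M.descLeft hM p _ _ fun l' =>
    have hl : (l'.1.splitLengths l.1).map List.length = l'.1 :=
      List.map_splitLengths_length _ _ (le_of_eq l'.2)
    have hf : (l'.1.splitLengths l.1).flatten = l.1 :=
      List.flatten_splitLengths _ _ (le_of_eq l'.2.symm)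
    eqToHom (by rw [hl, hf]) ≫
      M.colAssocTerm p q hpq B C D (l'.1.splitLengths l.1) (by rw [hf]; exact l.2)

theorem hasInitial [HasCoproducts.{0} V] : HasInitial V :=
  haveI : HasColimitsOfShape (Discrete PEmpty.{1}) V := inferInstance
  inferInstance

/-- The unit collection `(∅, I, ∅, ∅, …)`, where `∅` is the initial object. -/
noncomputable def colUnit [HasCoproducts.{0} V] : ℕ → V
  | 0 => haveI : HasInitial V := hasInitial; ⊥_ V
  | 1 => M.unit
  | _ + 2 => haveI : HasInitial V := hasInitial; ⊥_ V

/-- The canonical map `C ⟶ 𝓘 ⊗^{pq} C`, whose value in degree `j` is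
`C(j) = I ⊗_p C(j) ⟶ ∐ 𝓘(k) ⊗_p (C(j₁) ⊗_q ⋯ ⊗_q C(j_k))`. -/
noncomputable def colLeftUnitorInv [HasCoproducts.{0} V] (p q : Fin n) (C : ℕ → V) (j : ℕ) :
    C j ⟶ M.colTensor p q M.colUnit C j :=
  (M.leftUnitor p (C j)).inv ≫ M.hom p (𝟙 M.unit) (M.rightUnitor q (C j)).inv ≫
    M.colι p q M.colUnit C (k := 1) [j] rfl (by simp)

/-- The canonical map `C ⟶ C ⊗^{pq} 𝓘`, whose value in degree `j` is
`C(j) = C(j) ⊗_p (I ⊗_q ⋯ ⊗_q I) ⟶ ∐ C(k) ⊗_p (𝓘(j₁) ⊗_q ⋯ ⊗_q 𝓘(j_k))`. -/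
noncomputable def colRightUnitorInv [HasCoproducts.{0} V] (p q : Fin n) (C : ℕ → V) (j : ℕ) :
    C j ⟶ M.colTensor p q C M.colUnit j :=
  (M.rightUnitor p (C j)).inv ≫
    M.hom p (𝟙 (C j)) (M.iterUnit q (C := M.colUnit) (𝟙 M.unit) j) ≫
    M.colι p q C M.colUnit (List.replicate j 1) List.length_replicate (by simp)

/-! The two maps are isomorphisms, since all other summands are initial. -/

theorem isIso_sigmaι {J : Type} (X : J → V) [HasCoproduct X] (a : J)
    (hX : ∀ b, b ≠ a → Nonempty (IsInitial (X b))) : IsIso (Sigma.ι X a) := by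
  classical
  refine ⟨⟨Sigma.desc fun b =>
    if h : b = a then eqToHom (by rw [h]) else (hX b h).some.to _, by simp, ?_⟩⟩
  apply Sigma.hom_ext
  intro b
  by_cases h : b = a
  · subst h
    simp
  · exact (hX b h).some.hom_ext _ _

theorem isInitial_ob_left (hM : M.PreservesCoproducts) (i : Fin n) {A : V} (B : V)
    (hA : Nonempty (IsInitial A)) : Nonempty (IsInitial (M.ob i A B)) :=
  haveI := hM.left i B PEmpty
  ⟨IsInitial.isInitialObj ((M.tensor i).flip.obj B) A hA.some⟩

theorem isInitial_ob_right (hM : M.PreservesCoproducts) (i : Fin n) (A : V) {B : V}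
    (hB : Nonempty (IsInitial B)) : Nonempty (IsInitial (M.ob i A B)) :=
  haveI := hM.right i A PEmpty
  ⟨IsInitial.isInitialObj ((M.tensor i).obj A) B hB.some⟩

theorem isInitial_iter (hM : M.PreservesCoproducts) (q : Fin n) {β : Type} (f : β → V) {b : β}
    (hb : Nonempty (IsInitial (f b))) :
    ∀ l : List β, b ∈ l → Nonempty (IsInitial (M.iter q f l))
  | [], h => by simp at h
  | a :: l, h => by
      rcases List.mem_cons.mp h with h | h
      · subst h
        exact M.isInitial_ob_left hM q _ hb
      · exact M.isInitial_ob_right hM q _ (isInitial_iter hM q f hb l h)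

theorem isInitial_colUnit [HasCoproducts.{0} V] :
    ∀ k : ℕ, k ≠ 1 → Nonempty (IsInitial (M.colUnit k))
  | 0, _ => haveI : HasInitial V := hasInitial; ⟨initialIsInitial⟩
  | 1, h => absurd rfl h
  | _ + 2, _ => haveI : HasInitial V := hasInitial; ⟨initialIsInitial⟩

theorem isIso_hom (i : Fin n) {A A' B B' : V} (f : A ⟶ A') (g : B ⟶ B') [IsIso f] [IsIso g] :
    IsIso (M.hom i f g) := by
  unfold TensorData.hom
  infer_instance

theorem isIso_iterUnit (q : Fin n) {C : ℕ → V} (J : M.unit ⟶ C 1) [IsIso J] :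
    ∀ k : ℕ, IsIso (M.iterUnit q J k)
  | 0 => by
      unfold iterUnit
      exact IsIso.id _
  | k + 1 => by
      have := isIso_iterUnit q J k
      have h := M.isIso_hom q J (M.iterUnit q J k)
      exact IsIso.comp_isIso' (f := (M.leftUnitor q M.unit).inv) inferInstance h

theorem isIso_colι [HasCoproducts.{0} V] (p q : Fin n) (B C : ℕ → V) {k j : ℕ} (l : List ℕ)
    (hk : l.length = k) (hj : l.sum = j)
    (hX : ∀ l' : List ℕ, l'.sum = j → l' ≠ l →
      Nonempty (IsInitial (M.ob p (B l'.length) (M.iter q C l')))) :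
    IsIso (M.colι p q B C l hk hj) := by
  have h := isIso_sigmaι
    (fun l : {l : List ℕ // l.sum = j} => M.ob p (B l.1.length) (M.iter q C l.1)) ⟨l, hj⟩
    (fun b hb => hX b.1 b.2 fun h => hb (Subtype.ext h))
  exact IsIso.comp_isIso' inferInstance h

theorem isIso_colLeftUnitorInv [HasCoproducts.{0} V] (hM : M.PreservesCoproducts) (p q : Fin n)
    (C : ℕ → V) (j : ℕ) : IsIso (M.colLeftUnitorInv p q C j) := by
  have h := M.isIso_colι p q M.colUnit C (k := 1) (j := j) [j] rfl (by simp) (by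
    intro l hl hne
    apply M.isInitial_ob_left hM
    apply M.isInitial_colUnit
    intro h
    obtain ⟨a, rfl⟩ := List.length_eq_one_iff.mp h
    exact hne (by simpa using hl))
  exact IsIso.comp_isIso' inferInstance
    (IsIso.comp_isIso' (M.isIso_hom p (𝟙 M.unit) (M.rightUnitor q (C j)).inv) h)

theorem isIso_colRightUnitorInv [HasCoproducts.{0} V] (hM : M.PreservesCoproducts) (p q : Fin n)
    (C : ℕ → V) (j : ℕ) : IsIso (M.colRightUnitorInv p q C j) := by
  have h := M.isIso_colι p q C M.colUnit (j := j) (List.replicate j 1) List.length_replicate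
    (by simp) (by
    intro l hl hne
    by_cases h : ∀ b ∈ l, b = 1
    · have h1 : l = List.replicate l.length 1 := List.eq_replicate_of_mem h
      have h2 : l.length = j := by
        rw [h1] at hl
        simpa using hl
      exact absurd (h2 ▸ h1) hne
    · push Not at h
      obtain ⟨b, hb, hb1⟩ := h
      exact M.isInitial_ob_right hM p _
        (M.isInitial_iter hM q _ (M.isInitial_colUnit b hb1) l hb))
  have h1 := @isIso_iterUnit _ _ _ M q M.colUnit (𝟙 M.unit) (IsIso.id M.unit) j
  exact IsIso.comp_isIso' inferInstance (IsIso.comp_isIso'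
    (M.isIso_hom p (𝟙 (C j)) (M.iterUnit q (C := M.colUnit) (𝟙 M.unit) j)) h)

/-- The left unitor `𝓘 ⊗^{pq} C ≅ C`. -/
noncomputable def colLeftUnitor [HasCoproducts.{0} V] (hM : M.PreservesCoproducts) (p q : Fin n)
    (C : ℕ → V) (j : ℕ) : M.colTensor p q M.colUnit C j ≅ C j :=
  haveI := M.isIso_colLeftUnitorInv hM p q C j
  (asIso (M.colLeftUnitorInv p q C j)).symm

/-- The right unitor `C ⊗^{pq} 𝓘 ≅ C`. -/
noncomputable def colRightUnitor [HasCoproducts.{0} V] (hM : M.PreservesCoproducts) (p q : Fin n)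
    (C : ℕ → V) (j : ℕ) : M.colTensor p q C M.colUnit j ≅ C j :=
  haveI := M.isIso_colRightUnitorInv hM p q C j
  (asIso (M.colRightUnitorInv p q C j)).symm

/-! ### Operads as monoids of collections -/

/-- The structure of a monoid on the collection `C`, for the lax monoidal product `⊗^{pq}`. -/
structure ColMonoid [HasCoproducts.{0} V] (hM : M.PreservesCoproducts) (p q : Fin n) (hpq : p < q)
    (C : ℕ → V) where
  one (j : ℕ) : M.colUnit j ⟶ C j
  mul (j : ℕ) : M.colTensor p q C C j ⟶ C j
  mul_assoc (j : ℕ) :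
    M.colTensorHom p q mul (fun k => 𝟙 (C k)) j ≫ mul j =
      M.colAssoc hM p q hpq C C C j ≫ M.colTensorHom p q (fun k => 𝟙 (C k)) mul j ≫ mul j
  one_mul (j : ℕ) :
    M.colTensorHom p q one (fun k => 𝟙 (C k)) j ≫ mul j = (M.colLeftUnitor hM p q C j).hom
  mul_one (j : ℕ) :
    M.colTensorHom p q (fun k => 𝟙 (C k)) one j ≫ mul j = (M.colRightUnitor hM p q C j).hom

namespace ColMonoid

variable {M} [HasCoproducts.{0} V] {hM : M.PreservesCoproducts} {p q : Fin n} {hpq : p < q}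
  {C D : ℕ → V}

/-- The component `C(k) ⊗_p (C(j₁) ⊗_q ⋯ ⊗_q C(j_k)) ⟶ C(j)` of the multiplication. -/
noncomputable def comp (N : M.ColMonoid hM p q hpq C) {k j : ℕ} (l : List ℕ) (hk : l.length = k)
    (hj : l.sum = j) : M.ob p (C k) (M.iter q C l) ⟶ C j :=
  M.colι p q C C l hk hj ≫ N.mul j

/-- For `p ≤ q` and `s ≤ r`, the monoid structure `N'` for `⊗^{ps}` is built from the monoid structure
`N` for `⊗^{qr}` and the interchanges: the units are equal, and
`γ^{ps} = γ^{qr} ∘ (η^{pq} ∘ (1 ⊗ η^{sr}))`. -/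
structure BuiltFrom {p s q r : Fin n} {hps : p < s} {hqr : q < r} (hpq : p ≤ q) (hsr : s ≤ r)
    (N' : M.ColMonoid hM p s hps C) (N : M.ColMonoid hM q r hqr C) : Prop where
  one (j : ℕ) : N'.one j = N.one j
  comp (k j : ℕ) (l : List ℕ) (hk : l.length = k) (hj : l.sum = j) :
    N'.comp l hk hj = M.domainChange p s q r hpq hsr (C k) C l ≫ N.comp l hk hj

/-- Homomorphisms of monoids in the category of collections. -/
structure IsHom (N : M.ColMonoid hM p q hpq C) (N' : M.ColMonoid hM p q hpq D)
    (f : ∀ j, C j ⟶ D j) : Prop where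
  one (j : ℕ) : N.one j ≫ f j = N'.one j
  mul (j : ℕ) : N.mul j ≫ f j = M.colTensorHom p q f f j ≫ N'.mul j

end ColMonoid

/-- The product number `m - 1`, for `2 ≤ m ≤ n`. -/
def lower {n : ℕ} (m : ℕ) (hm : 2 ≤ m) (hn : m ≤ n) : Fin n := ⟨m - 2, by omega⟩

/-- The product number `m`, for `2 ≤ m ≤ n`. -/
def upper {n : ℕ} (m : ℕ) (hm : 2 ≤ m) (hn : m ≤ n) : Fin n := ⟨m - 1, by omega⟩

theorem lower_lt_upper {n : ℕ} (m : ℕ) (hm : 2 ≤ m) (hn : m ≤ n) :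
    lower m hm hn < upper m hm hn :=
  Fin.mk_lt_mk.mpr (by omega)

theorem le_lower {n : ℕ} {m : ℕ} {hm : 2 ≤ m} {hn : m ≤ n} {p s : Fin n} (hps : p < s)
    (hs : s ≤ upper m hm hn) : p ≤ lower m hm hn := by
  have h1 := Fin.lt_def.mp hps
  have h2 := Fin.le_def.mp hs
  simp only [upper] at h2
  simp only [lower, Fin.le_def]
  omega

/-- An `m`-fold operad structure on the collection `C` in condensed form: a monoid structure in
`Col_m(V)`, the category of collections with the product `⊗^{m-1,m}`. -/
abbrev CondensedOperad [HasCoproducts.{0} V] (hM : M.PreservesCoproducts) (m : ℕ) (hm : 2 ≤ m)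
    (hn : m ≤ n) (C : ℕ → V) :=
  M.ColMonoid hM (lower m hm hn) (upper m hm hn) (lower_lt_upper m hm hn) C

/-- An expanded operad structure and a monoid structure on `C` agree if they have the same unit
`I ⟶ C(1)` and if the composition `γ^{m-1,m}` is the multiplication. -/
structure Agree [HasCoproducts.{0} V] {hM : M.PreservesCoproducts} {m : ℕ} {hm : 2 ≤ m}
    {hn : m ≤ n} {C : ℕ → V} (O : M.ExpandedOperad m C) (N : M.CondensedOperad hM m hm hn C) :
    Prop where
  unit : O.unit = N.one 1
  comp (k j : ℕ) (l : List ℕ) (hpos : 1 ≤ k) (hk : l.length = k) (hj : l.sum = j) :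
    O.comp (lower m hm hn) (upper m hm hn) (lower_lt_upper m hm hn) (Nat.sub_one_lt_of_lt hm)
      l hpos hk hj = N.comp l hk hj

end IteratedMonoidal

/-! The maps `change`, that is `η^{pq}_{AIIB}`, make the identity functor lax monoidal from `⊗_q` to
`⊗_p`. The unit laws are `change_unit_left` and `change_unit_right`, and associativity is
`change_assoc`. Putting units into the giant hexagon shows in addition that these maps slide through
the remaining interchangers on either index (`change_eta`, `eta_comp_change`) and that they compose
(`change_trans`).

Hence an operad for the pair `(q, r)` pulls back along `domainChange` to an operad for every pair
`(p, s)` with `p < s`, `p ≤ q` and `s ≤ r`. This is `IsOperad.change`, the core of the proof.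
Applied to the pair `(m-1, m)` it produces every `γ^{ps}` of an expanded operad and every further
monoid structure.

For a single pair, monoids and operads are the same thing. The products preserve coproducts, so a
monoid axiom can be tested on summands, where it becomes an operad axiom (`mul_assoc_iff`,
`one_mul_iff`, `mul_one_iff`). The summand with `k = 0` carries no freedom, because the right unit
axiom forces its composition (`IsOperad.nil`). So compositions with `k ≥ 1` suffice.

Compatibility with `q + 1 = m` expresses every `γ^{ps}` through `γ^{m-1,m}`, which gives uniqueness.
Conversely, pulled back compositions are compatible because `domainChange` is transitive. -/

namespace TensorData

variable {n : ℕ} {V : Type u} [Category.{v} V] (T : TensorData n V)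

@[simp]
theorem hom_id (i : Fin n) (A B : V) : T.hom i (𝟙 A) (𝟙 B) = 𝟙 (T.ob i A B) := by
  simp [hom]

@[simp]
theorem hom_comp_hom (i : Fin n) {A A' A'' B B' B'' : V} (f : A ⟶ A') (f' : A' ⟶ A'')
    (g : B ⟶ B') (g' : B' ⟶ B'') :
    T.hom i f g ≫ T.hom i f' g' = T.hom i (f ≫ f') (g ≫ g') := by
  simp [hom]

@[simp]
theorem hom_comp_hom_assoc (i : Fin n) {A A' A'' B B' B'' Z : V} (f : A ⟶ A') (f' : A' ⟶ A'')
    (g : B ⟶ B') (g' : B' ⟶ B'') (h : T.ob i A'' B'' ⟶ Z) :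
    T.hom i f g ≫ T.hom i f' g' ≫ h = T.hom i (f ≫ f') (g ≫ g') ≫ h := by
  rw [← Category.assoc, hom_comp_hom]

end TensorData

/-! ### Coherence within one product -/

namespace IteratedMonoidal

variable {n : ℕ} {V : Type u} [Category.{v} V] (M : IteratedMonoidal n V)

/-- One of the products, as a monoidal structure in the sense of Mathlib. -/
@[reducible]
def toMonoidalCategory (i : Fin n) : MonoidalCategory V :=
  letI : MonoidalCategoryStruct V :=
    { tensorObj := M.ob i
      whiskerLeft := fun X _ _ f => M.hom i (𝟙 X) f
      whiskerRight := fun f Y => M.hom i f (𝟙 Y)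
      tensorHom := fun f g => M.hom i f g
      tensorUnit := M.unit
      associator := M.assoc i
      leftUnitor := M.leftUnitor i
      rightUnitor := M.rightUnitor i }
  MonoidalCategory.ofTensorHom
    (id_tensorHom_id := M.hom_id i)
    (id_tensorHom := fun _ _ _ _ => rfl)
    (tensorHom_id := fun _ _ => rfl)
    (tensorHom_comp_tensorHom := fun _ _ _ _ => M.hom_comp_hom i _ _ _ _)
    (associator_naturality := M.assoc_naturality i)
    (leftUnitor_naturality := M.leftUnitor_naturality i)
    (rightUnitor_naturality := M.rightUnitor_naturality i)
    (pentagon := M.pentagon i)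
    (triangle := M.triangle i)

/-- This and the next two laws follow from pentagon, triangle and naturality. They are imported from
Mathlib through `toMonoidalCategory`. -/
theorem leftUnitor_unit (i : Fin n) :
    (M.leftUnitor i M.unit).hom = (M.rightUnitor i M.unit).hom :=
  letI := M.toMonoidalCategory i
  MonoidalCategory.unitors_equal (C := V)

theorem assoc_leftUnitor (i : Fin n) (A B : V) :
    (M.assoc i M.unit A B).hom ≫ (M.leftUnitor i (M.ob i A B)).hom =
      M.hom i (M.leftUnitor i A).hom (𝟙 B) :=
  letI := M.toMonoidalCategory i
  (MonoidalCategory.leftUnitor_whiskerRight (C := V) A B).symm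

theorem assoc_rightUnitor (i : Fin n) (A B : V) :
    (M.assoc i A B M.unit).hom ≫ M.hom i (𝟙 A) (M.rightUnitor i B).hom =
      (M.rightUnitor i (M.ob i A B)).hom :=
  letI := M.toMonoidalCategory i
  (MonoidalCategory.rightUnitor_tensor_hom (C := V) A B).symm

theorem leftUnitor_inv_naturality (i : Fin n) {A A' : V} (f : A ⟶ A') :
    (M.leftUnitor i A).inv ≫ M.hom i (𝟙 M.unit) f = f ≫ (M.leftUnitor i A').inv := by
  rw [Iso.inv_comp_eq, ← Category.assoc, ← M.leftUnitor_naturality, Category.assoc,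
    Iso.hom_inv_id, Category.comp_id]

theorem rightUnitor_inv_naturality (i : Fin n) {A A' : V} (f : A ⟶ A') :
    (M.rightUnitor i A).inv ≫ M.hom i f (𝟙 M.unit) = f ≫ (M.rightUnitor i A').inv := by
  rw [Iso.inv_comp_eq, ← Category.assoc, ← M.rightUnitor_naturality, Category.assoc,
    Iso.hom_inv_id, Category.comp_id]

theorem assoc_inv_naturality (i : Fin n) {A A' B B' C C' : V} (f : A ⟶ A') (g : B ⟶ B')
    (h : C ⟶ C') :
    M.hom i f (M.hom i g h) ≫ (M.assoc i A' B' C').inv =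
      (M.assoc i A B C).inv ≫ M.hom i (M.hom i f g) h := by
  rw [Iso.comp_inv_eq, Category.assoc, M.assoc_naturality, Iso.inv_hom_id_assoc]

/-! ### Interchangers with two units among their objects -/

section Units

variable {i j : Fin n} (h : i < j)

/-- The inverse unitors in the definition of `change` are moved to the other side. Inner objects
that merely map to `I`, such as `I ⊗ I`, are allowed, since specialised axioms produce them. -/
theorem eta_change (A B : V) {X Y : V} (x : X ⟶ M.unit) (y : Y ⟶ M.unit) :
    M.eta i j h A X Y B ≫ M.hom j (M.hom i (𝟙 A) y ≫ (M.rightUnitor i A).hom)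
        (M.hom i x (𝟙 B) ≫ (M.leftUnitor i B).hom) =
      M.hom i (M.hom j (𝟙 A) x ≫ (M.rightUnitor j A).hom)
        (M.hom j y (𝟙 B) ≫ (M.leftUnitor j B).hom) ≫ M.change i j h.le A B := by
  rw [change, dif_pos h]
  simp only [TensorData.hom_comp_hom_assoc, Category.assoc, Iso.hom_inv_id, Category.comp_id]
  rw [reassoc_of% M.eta_naturality, TensorData.hom_comp_hom]

theorem change_naturality {i j : Fin n} (h : i ≤ j) {A A' B B' : V} (f : A ⟶ A') (g : B ⟶ B') :
    M.hom i f g ≫ M.change i j h A' B' = M.change i j h A B ≫ M.hom j f g := by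
  rcases h.lt_or_eq with h | rfl
  · rw [change, dif_pos h, change, dif_pos h]
    simp only [Category.assoc, TensorData.hom_comp_hom, TensorData.hom_comp_hom_assoc]
    rw [← M.rightUnitor_inv_naturality, ← M.leftUnitor_inv_naturality, ← M.rightUnitor_naturality,
      ← M.leftUnitor_naturality, ← TensorData.hom_comp_hom, Category.assoc,
      reassoc_of% M.eta_naturality, TensorData.hom_comp_hom]
  · simp [change]

@[simp]
theorem change_self (i : Fin n) (A B : V) : M.change i i le_rfl A B = 𝟙 _ := by
  simp [change]

theorem isIso_hom_iso (i : Fin n) {A A' B B' : V} (f : A ≅ A') (g : B ≅ B') :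
    IsIso (M.hom i f.hom g.hom) :=
  M.isIso_hom i f.hom g.hom

/-- For `A = I` the interchanger `η_{AIIB}` is also an instance of `η_{IIAB}`, which the internal
unit condition determines. The two readings differ by the left and right unitors of `I`, which
coincide. -/
theorem change_unit_left {i j : Fin n} (h : i ≤ j) (X : V) :
    M.change i j h M.unit X ≫ (M.leftUnitor j X).hom = (M.leftUnitor i X).hom := by
  rcases h.lt_or_eq with h | rfl
  · have e := M.isIso_hom_iso i (M.rightUnitor j M.unit) (M.leftUnitor j X)
    have h1 := M.eta_change h M.unit X (𝟙 M.unit) (𝟙 M.unit)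
    have h2 := M.internal_unit_left i j h M.unit X
    simp only [TensorData.hom_id, Category.id_comp] at h1
    rw [M.leftUnitor_unit, M.leftUnitor_unit, h1] at h2
    have h3 := M.leftUnitor_naturality i (M.leftUnitor j X).hom
    rw [← cancel_epi (M.hom i (M.rightUnitor j M.unit).hom (M.leftUnitor j X).hom),
      reassoc_of% h2, ← h3, TensorData.hom_comp_hom_assoc, Category.comp_id, Category.id_comp]
  · simp

theorem change_unit_right {i j : Fin n} (h : i ≤ j) (X : V) :
    M.change i j h X M.unit ≫ (M.rightUnitor j X).hom = (M.rightUnitor i X).hom := by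
  rcases h.lt_or_eq with h | rfl
  · have e := M.isIso_hom_iso i (M.rightUnitor j X) (M.leftUnitor j M.unit)
    have h1 := M.eta_change h X M.unit (𝟙 M.unit) (𝟙 M.unit)
    have h2 := M.internal_unit_right i j h X M.unit
    simp only [TensorData.hom_id, Category.id_comp] at h1
    rw [← M.leftUnitor_unit i, h1] at h2
    have h3 := M.rightUnitor_naturality i (M.rightUnitor j X).hom
    rw [← cancel_epi (M.hom i (M.rightUnitor j X).hom (M.leftUnitor j M.unit).hom),
      reassoc_of% h2, ← h3, TensorData.hom_comp_hom_assoc, Category.comp_id, Category.id_comp]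
  · simp

end Units

/-! ### The maps `η_{AIIB}` and the interchangers -/

section Hexagon

variable {i j k : Fin n}

/-- This is the hexagon with its four middle objects equal to `I`. The instances of `η^{ij}` become
`change`, and the internal unit conditions remove the interchangers `η_{ABII}` and `η_{IICD}`. -/
theorem change_eta (hij : i ≤ j) (hjk : j < k) (A B C D : V) :
    M.change i j hij (M.ob k A B) (M.ob k C D) ≫ M.eta j k hjk A B C D =
      M.eta i k (hij.trans_lt hjk) A B C D ≫
        M.hom k (M.change i j hij A C) (M.change i j hij B D) := by
  rcases hij.lt_or_eq with hij | rfl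
  · have e : IsIso (M.hom i (M.hom j (𝟙 (M.ob k A B)) (M.leftUnitor k M.unit).hom)
        (M.hom j (M.leftUnitor k M.unit).hom (𝟙 (M.ob k C D)))) :=
      @isIso_hom _ _ _ M i _ _ _ _ _ _
        (M.isIso_hom_iso j (Iso.refl (M.ob k A B)) (M.leftUnitor k M.unit))
        (M.isIso_hom_iso j (M.leftUnitor k M.unit) (Iso.refl (M.ob k C D)))
    have e' := M.isIso_hom_iso i (M.rightUnitor j (M.ob k A B)) (M.leftUnitor j (M.ob k C D))
    -- The appended unitors absorb the leftover units in the common target. Those in the source are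
    -- cancelled at the end by means of `e` and `e'`.
    have h := M.hexagon i j k hij hjk A B M.unit M.unit M.unit M.unit C D =≫
      M.hom k (M.hom j (M.rightUnitor i A).hom (M.leftUnitor i C).hom)
        (M.hom j (M.rightUnitor i B).hom (M.leftUnitor i D).hom)
    have a (X Y : V) := M.eta_change hij X Y (𝟙 M.unit) (𝟙 M.unit)
    simp only [TensorData.hom_id, Category.id_comp] at a
    simp only [Category.assoc, TensorData.hom_comp_hom, a] at h
    rw [← TensorData.hom_comp_hom, ← reassoc_of% M.eta_naturality, ← M.eta_naturality,
      TensorData.hom_comp_hom_assoc, TensorData.hom_comp_hom_assoc,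
      M.internal_unit_right, M.internal_unit_left, M.internal_unit_right, M.internal_unit_left,
      reassoc_of% M.eta_change, ← TensorData.hom_comp_hom, Category.assoc, Category.assoc] at h
    exact ((cancel_epi _).mp ((cancel_epi _).mp h)).symm
  · simp

/-- Here the units of the hexagon sit so that the instances of `η^{jk}` become `change`, while the
external unit conditions remove `η_{AICI}` and `η_{IBID}`. -/
theorem eta_comp_change (hij : i < j) (hjk : j ≤ k) (A B C D : V) :
    M.eta i j hij A B C D ≫ M.change j k hjk (M.ob i A C) (M.ob i B D) =
      M.hom i (M.change j k hjk A B) (M.change j k hjk C D) ≫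
        M.eta i k (hij.trans_le hjk) A B C D := by
  rcases hjk.lt_or_eq with hjk | rfl
  · have e := @isIso_hom _ _ _ M i _ _ _ _ _ _
      (M.isIso_hom_iso j (M.rightUnitor k A) (M.leftUnitor k B))
      (M.isIso_hom_iso j (M.rightUnitor k C) (M.leftUnitor k D))
    have h := M.hexagon i j k hij hjk A M.unit M.unit B C M.unit M.unit D =≫
      M.hom k (M.hom j (𝟙 (M.ob i A C)) (M.leftUnitor i M.unit).hom ≫ (M.rightUnitor j _).hom)
        (M.hom j (M.leftUnitor i M.unit).hom (𝟙 (M.ob i B D)) ≫ (M.leftUnitor j _).hom)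
    have a (X Y : V) := M.eta_change hjk X Y (𝟙 M.unit) (𝟙 M.unit)
    simp only [TensorData.hom_id, Category.id_comp] at a
    simp only [Category.assoc, TensorData.hom_comp_hom, M.external_unit_right,
      M.external_unit_left] at h
    rw [← M.eta_naturality, TensorData.hom_comp_hom_assoc, a, a, M.eta_change,
      TensorData.hom_comp_hom_assoc, M.external_unit_right,
      M.external_unit_left, ← reassoc_of% M.eta_naturality, ← TensorData.hom_comp_hom,
      Category.assoc] at h
    exact ((cancel_epi _).mp h).symm
  · simp

/-- This is `change_eta` at the objects `A, I, I, B`, where the two changes inside the last product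
reduce to unitors. -/
theorem change_trans (hij : i ≤ j) (hjk : j ≤ k) (A B : V) :
    M.change i j hij A B ≫ M.change j k hjk A B = M.change i k (hij.trans hjk) A B := by
  rcases hjk.lt_or_eq with hjk | rfl
  · have e := M.isIso_hom_iso i (M.rightUnitor k A) (M.leftUnitor k B)
    have h := M.change_eta hij hjk A M.unit M.unit B =≫
      M.hom k (M.rightUnitor j A).hom (M.leftUnitor j B).hom
    have a {i j : Fin n} (hij : i < j) (X Y : V) := M.eta_change hij X Y (𝟙 M.unit) (𝟙 M.unit)
    simp only [TensorData.hom_id, Category.id_comp] at a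
    rw [Category.assoc, Category.assoc, TensorData.hom_comp_hom, M.change_unit_right,
      M.change_unit_left, a, a, ← reassoc_of% M.change_naturality] at h
    exact (cancel_epi _).mp h
  · simp

end Hexagon

/-! ### The maps `change` and the associators -/

/-- The map `(A ⊗ⱼ B) ⊗ᵢ C ⟶ A ⊗ⱼ (B ⊗ᵢ C)`, an instance of the interchanger with one unit. -/
def etaUnit {i j : Fin n} (h : i < j) (A B C : V) :
    M.ob i (M.ob j A B) C ⟶ M.ob j A (M.ob i B C) :=
  M.hom i (𝟙 _) (M.leftUnitor j C).inv ≫ M.eta i j h A B M.unit C ≫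
    M.hom j (M.rightUnitor i A).hom (𝟙 _)

/-- The source is internal associativity for the three pairs `(A, I)`, `(I, B)`, `(I, C)`. -/
theorem change_comp_etaUnit {i j : Fin n} (h : i < j) (A B C : V) :
    M.hom i (M.change i j h.le A B) (𝟙 C) ≫ M.etaUnit h A B C =
      (M.assoc i A B C).hom ≫ M.change i j h.le A (M.ob i B C) := by
  have e := @isIso_hom _ _ _ M i _ _ _ _ _ _
    (M.isIso_hom_iso i (M.rightUnitor j A) (M.leftUnitor j B))
    (inferInstance : IsIso (M.leftUnitor j C).hom)
  have h1 := M.internal_assoc i j h A M.unit M.unit B M.unit C =≫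
    M.hom j (M.hom i (𝟙 A) (M.leftUnitor i M.unit).hom ≫ (M.rightUnitor i A).hom)
      (M.leftUnitor i (M.ob i B C)).hom
  have h2 := M.eta_change h A (M.ob i B C) (𝟙 M.unit) (M.leftUnitor i M.unit).hom
  have h3 := M.eta_change h A B (𝟙 M.unit) (𝟙 M.unit)
  have h4 := M.external_unit_left i j h B C
  simp only [TensorData.hom_id, Category.id_comp] at h2 h3
  simp only [Category.assoc, TensorData.hom_comp_hom] at h1
  rw [h2, M.assoc_leftUnitor, reassoc_of% M.triangle, TensorData.hom_comp_hom_assoc, h4,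
    Category.id_comp] at h1
  rw [← cancel_epi (M.hom i (M.hom i (M.rightUnitor j A).hom (M.leftUnitor j B).hom)
    (M.leftUnitor j C).hom), reassoc_of% M.assoc_naturality, ← h1, etaUnit]
  simp only [TensorData.hom_comp_hom_assoc, Category.comp_id, Category.id_comp, Iso.hom_inv_id]
  have h5 : M.hom j (M.hom i (M.rightUnitor i A).hom (𝟙 M.unit) ≫ (M.rightUnitor i A).hom)
      (M.hom i (M.leftUnitor i B).hom (𝟙 C)) =
      M.hom j (M.hom i (M.rightUnitor i A).hom (𝟙 M.unit)) (M.hom i (M.leftUnitor i B).hom (𝟙 C)) ≫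
        M.hom j (M.rightUnitor i A).hom (𝟙 (M.ob i B C)) := by
    simp
  rw [← h3, h5, ← reassoc_of% M.eta_naturality]
  simp

/-- The source is external associativity for the triples `(A, B, I)` and `(I, I, C)`. -/
theorem etaUnit_comp_change {i j : Fin n} (h : i < j) (A B C : V) :
    M.etaUnit h A B C ≫ M.hom j (𝟙 A) (M.change i j h.le B C) =
      M.change i j h.le (M.ob j A B) C ≫ (M.assoc j A B C).hom := by
  have e0 := M.isIso_hom_iso j (M.leftUnitor j M.unit) (Iso.refl C)
  have e1 : IsIso (M.hom j (M.leftUnitor j M.unit).hom (𝟙 C) ≫ (M.leftUnitor j C).hom) :=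
    @IsIso.comp_isIso _ _ _ _ _ _ _ e0 _
  have e := M.isIso_hom i (M.rightUnitor j (M.ob j A B)).hom
    (M.hom j (M.leftUnitor j M.unit).hom (𝟙 C) ≫ (M.leftUnitor j C).hom)
  have h1 := M.external_assoc i j h A B M.unit M.unit M.unit C =≫
    M.hom j (M.rightUnitor i A).hom (M.hom j (M.rightUnitor i B).hom (M.leftUnitor i C).hom)
  have h2 := M.eta_change h (M.ob j A B) C (𝟙 M.unit) (M.leftUnitor j M.unit).hom
  have h3 := M.eta_change h B C (𝟙 M.unit) (𝟙 M.unit)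
  simp only [TensorData.hom_id, Category.id_comp] at h2 h3
  simp only [Category.assoc, TensorData.hom_comp_hom, ← M.assoc_naturality,
    TensorData.hom_comp_hom_assoc, M.internal_unit_right, h3, Category.id_comp] at h1
  rw [reassoc_of% h2] at h1
  rw [← cancel_epi (M.hom i (M.rightUnitor j (M.ob j A B)).hom
    (M.hom j (M.leftUnitor j M.unit).hom (𝟙 C) ≫ (M.leftUnitor j C).hom)), h1]
  have h4 : M.hom j (M.rightUnitor i A).hom
      (M.hom i (M.rightUnitor j B).hom (M.leftUnitor j C).hom ≫ M.change i j h.le B C) =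
      M.hom j (M.hom i (𝟙 A) (𝟙 M.unit)) (M.hom i (M.rightUnitor j B).hom (M.leftUnitor j C).hom) ≫
        M.hom j (M.rightUnitor i A).hom (M.change i j h.le B C) := by
    simp
  rw [h4, ← reassoc_of% M.eta_naturality, TensorData.hom_comp_hom_assoc, M.assoc_rightUnitor,
    M.triangle, etaUnit, M.leftUnitor_unit]
  simp

/-- The map `etaUnit` is a diagonal that cuts this diagram into two parts, one owed to internal and
one to external associativity. -/
theorem change_assoc {i j : Fin n} (h : i ≤ j) (A B C : V) :
    M.hom i (M.change i j h A B) (𝟙 C) ≫ M.change i j h (M.ob j A B) C ≫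
        (M.assoc j A B C).hom =
      (M.assoc i A B C).hom ≫ M.hom i (𝟙 A) (M.change i j h B C) ≫
        M.change i j h A (M.ob j B C) := by
  rcases h.lt_or_eq with h | rfl
  · rw [← M.etaUnit_comp_change h, reassoc_of% M.change_comp_etaUnit, ← M.change_naturality]
  · simp

end IteratedMonoidal

namespace IteratedMonoidal

variable {n : ℕ} {V : Type u} [Category.{v} V] (M : IteratedMonoidal n V)

theorem leftUnitor_inv_change {i j : Fin n} (h : i ≤ j) (X : V) :
    (M.leftUnitor i X).inv ≫ M.change i j h M.unit X = (M.leftUnitor j X).inv := by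
  rw [Iso.inv_comp_eq, Iso.eq_comp_inv, M.change_unit_left]

theorem rightUnitor_inv_change {i j : Fin n} (h : i ≤ j) (X : V) :
    (M.rightUnitor i X).inv ≫ M.change i j h X M.unit = (M.rightUnitor j X).inv := by
  rw [Iso.inv_comp_eq, Iso.eq_comp_inv, M.change_unit_right]

theorem change_assoc_inv {i j : Fin n} (h : i ≤ j) (A B C : V) :
    M.hom i (𝟙 A) (M.change i j h B C) ≫ M.change i j h A (M.ob j B C) ≫
        (M.assoc j A B C).inv =
      (M.assoc i A B C).inv ≫ M.hom i (M.change i j h A B) (𝟙 C) ≫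
        M.change i j h (M.ob j A B) C := by
  rw [Iso.eq_inv_comp, ← reassoc_of% M.change_assoc]
  simp

/-! ### Iterated products of morphisms

The first lemmas are the inductive steps, for arbitrary objects in the places of the iterated
products. -/

theorem hom_comp_change_step {s r : Fin n} (h : s ≤ r) {A A' X X' Y Y' : V} (φ : A ⟶ A')
    {u : X ⟶ X'} {c' : X' ⟶ Y'} {c : X ⟶ Y} {v : Y ⟶ Y'} (e : u ≫ c' = c ≫ v) :
    M.hom s φ u ≫ M.hom s (𝟙 A') c' ≫ M.change s r h A' Y' =
      (M.hom s (𝟙 A) c ≫ M.change s r h A Y) ≫ M.hom r φ v := by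
  rw [Category.assoc, ← M.change_naturality, TensorData.hom_comp_hom_assoc,
    TensorData.hom_comp_hom_assoc, e, Category.comp_id, Category.id_comp]

theorem change_comp_change_step {s r t : Fin n} (h : s ≤ r) (h' : r ≤ t) (A : V) {X Y Z : V}
    {c : X ⟶ Y} {c' : Y ⟶ Z} {c'' : X ⟶ Z} (e : c ≫ c' = c'') :
    (M.hom s (𝟙 A) c ≫ M.change s r h A Y) ≫ M.hom r (𝟙 A) c' ≫ M.change r t h' A Z =
      M.hom s (𝟙 A) c'' ≫ M.change s t (h.trans h') A Z := by
  rw [Category.assoc, ← reassoc_of% M.change_naturality, M.change_trans,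
    TensorData.hom_comp_hom_assoc, e, Category.comp_id]

theorem unit_comp_change_step {s r : Fin n} (h : s ≤ r) {A X Y : V} (J : M.unit ⟶ A)
    {u : M.unit ⟶ X} {c : X ⟶ Y} {u' : M.unit ⟶ Y} (e : u ≫ c = u') :
    ((M.leftUnitor s M.unit).inv ≫ M.hom s J u) ≫ M.hom s (𝟙 A) c ≫ M.change s r h A Y =
      (M.leftUnitor r M.unit).inv ≫ M.hom r J u' := by
  rw [Category.assoc, TensorData.hom_comp_hom_assoc, e, Category.comp_id, M.change_naturality,
    reassoc_of% M.leftUnitor_inv_change]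

theorem change_comp_append_step {s r : Fin n} (h : s ≤ r) (A : V) {X Y X₁ Y₁ X₂ Y₂ : V}
    {c : X ⟶ Y} {c₁ : X₁ ⟶ Y₁} {c₂ : X₂ ⟶ Y₂} {a : X ⟶ M.ob s X₁ X₂} {a' : Y ⟶ M.ob r Y₁ Y₂}
    (e : c ≫ a' = a ≫ M.hom s c₁ c₂ ≫ M.change s r h Y₁ Y₂) :
    (M.hom s (𝟙 A) c ≫ M.change s r h A Y) ≫ M.hom r (𝟙 A) a' ≫ (M.assoc r A Y₁ Y₂).inv =
      (M.hom s (𝟙 A) a ≫ (M.assoc s A X₁ X₂).inv) ≫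
        M.hom s (M.hom s (𝟙 A) c₁ ≫ M.change s r h A Y₁) c₂ ≫ M.change s r h (M.ob r A Y₁) Y₂ := by
  have e' : M.hom s (M.hom s (𝟙 A) c₁ ≫ M.change s r h A Y₁) c₂ =
      M.hom s (M.hom s (𝟙 A) c₁) c₂ ≫ M.hom s (M.change s r h A Y₁) (𝟙 Y₂) := by
    simp
  rw [Category.assoc, Category.assoc, e', Category.assoc,
    ← reassoc_of% M.assoc_inv_naturality, ← M.change_assoc_inv, ← reassoc_of% M.change_naturality]
  simp only [TensorData.hom_comp_hom_assoc, e, Category.comp_id]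

/-- The substance is `eta_comp_change`, which raises the outer index of `η^{ps}` to `r`. The
hypothesis `e` handles the splitting off of the first block and `e'` is the induction hypothesis. -/
theorem change_comp_eta_step {p s r : Fin n} (hps : p < s) (hsr : s ≤ r) (A : V)
    {X Y U U' W W' Z Z' E E' G : V} {c : X ⟶ Y} {d : U ⟶ U'} {d' : W ⟶ W'} {d'' : Z ⟶ Z'}
    {a : Z ⟶ M.ob s U W} {a' : Z' ⟶ M.ob r U' W'}
    (e : d'' ≫ a' = a ≫ M.hom s d d' ≫ M.change s r hsr U' W')
    {t : M.ob p X W ⟶ E} {t' : M.ob p Y W' ⟶ G} {m : E ⟶ E'} {g : E' ⟶ G}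
    (e' : M.hom p c d' ≫ t' = t ≫ m ≫ g) :
    M.hom p (M.hom s (𝟙 A) c ≫ M.change s r hsr A Y) d'' ≫
        M.hom p (𝟙 (M.ob r A Y)) a' ≫ M.eta p r (hps.trans_le hsr) A Y U' W' ≫
          M.hom r (𝟙 (M.ob p A U')) t' =
      (M.hom p (𝟙 (M.ob s A X)) a ≫ M.eta p s hps A X U W ≫ M.hom s (𝟙 (M.ob p A U)) t) ≫
        M.hom s (M.hom p (𝟙 A) d) m ≫ M.hom s (𝟙 (M.ob p A U')) g ≫
          M.change s r hsr (M.ob p A U') G := by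
  have e₁ : M.hom p (M.hom s (𝟙 A) c ≫ M.change s r hsr A Y)
      (a ≫ M.hom s d d' ≫ M.change s r hsr U' W') =
      M.hom p (𝟙 (M.ob s A X)) a ≫ M.hom p (M.hom s (𝟙 A) c) (M.hom s d d') ≫
        M.hom p (M.change s r hsr A Y) (M.change s r hsr U' W') := by
    simp
  rw [TensorData.hom_comp_hom_assoc, e, Category.comp_id, e₁]
  simp only [Category.assoc]
  rw [← reassoc_of% M.eta_comp_change hps hsr, ← M.change_naturality, reassoc_of% M.eta_naturality]
  simp only [TensorData.hom_comp_hom_assoc, e', Category.comp_id, Category.id_comp]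

/-- An associativity law for `⊗_q` pulls back to one for `⊗_p` because `change` respects
associators. -/
theorem change_comp_assoc_step {p q : Fin n} (hpq : p ≤ q) {A B X Y Z E F : V}
    {a : M.ob q A X ⟶ B} {b : M.ob q B Y ⟶ Z} {t : M.ob q X Y ⟶ E} {f : E ⟶ F}
    {c : M.ob q A F ⟶ Z} (e : M.hom q a (𝟙 Y) ≫ b =
      (M.assoc q A X Y).hom ≫ M.hom q (𝟙 A) t ≫ M.hom q (𝟙 A) f ≫ c) :
    M.hom p (M.change p q hpq A X ≫ a) (𝟙 Y) ≫ M.change p q hpq B Y ≫ b =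
      (M.assoc p A X Y).hom ≫ M.hom p (𝟙 A) ((M.change p q hpq X Y ≫ t) ≫ f) ≫
        M.change p q hpq A F ≫ c := by
  have e₁ : M.hom p (M.change p q hpq A X ≫ a) (𝟙 Y) =
      M.hom p (M.change p q hpq A X) (𝟙 Y) ≫ M.hom p a (𝟙 Y) := by
    simp
  have e₂ : M.hom p (𝟙 A) ((M.change p q hpq X Y ≫ t) ≫ f) =
      M.hom p (𝟙 A) (M.change p q hpq X Y) ≫ M.hom p (𝟙 A) (t ≫ f) := by
    simp
  rw [e₁, e₂, Category.assoc, Category.assoc, reassoc_of% M.change_naturality, e,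
    reassoc_of% M.change_assoc, TensorData.hom_comp_hom_assoc, Category.comp_id,
    ← reassoc_of% M.change_naturality]

/-- The counterpart for the smaller index of the interchanger, resting on `change_eta`. -/
theorem change_comp_eta_step' {p q r : Fin n} (hpq : p ≤ q) (hqr : q < r) (A : V)
    {X U W Z G E : V} (a : Z ⟶ M.ob r U W) {t : M.ob p X W ⟶ E} {t' : M.ob q X W ⟶ G}
    {m : E ⟶ G} (e : M.change p q hpq X W ≫ t' = t ≫ m) :
    M.change p q hpq (M.ob r A X) Z ≫ M.hom q (𝟙 (M.ob r A X)) a ≫ M.eta q r hqr A X U W ≫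
        M.hom r (𝟙 (M.ob q A U)) t' =
      (M.hom p (𝟙 (M.ob r A X)) a ≫ M.eta p r (hpq.trans_lt hqr) A X U W ≫
        M.hom r (𝟙 (M.ob p A U)) t) ≫ M.hom r (M.change p q hpq A U) m := by
  rw [← reassoc_of% M.change_naturality, reassoc_of% M.change_eta hpq hqr]
  simp only [TensorData.hom_comp_hom, e, Category.comp_id, Category.id_comp, Category.assoc]

section Iter

variable {β β' : Type}

theorem iterMap_id (q : Fin n) (f : β → V) :
    ∀ l : List β, M.iterMap q (fun b => 𝟙 (f b)) l = 𝟙 _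
  | [] => rfl
  | _ :: l => (congrArg (M.hom q _) (iterMap_id q f l)).trans (M.hom_id q _ _)

theorem iterMap_comp_iterMapTo (q : Fin n) {f g : β → V} {g' : β' → V} (r : β → β')
    (φ : ∀ b, f b ⟶ g b) (ψ : ∀ b, g b ⟶ g' (r b)) :
    ∀ l : List β, M.iterMap q φ l ≫ M.iterMapTo q r ψ l = M.iterMapTo q r (fun b => φ b ≫ ψ b) l
  | [] => Category.id_comp _
  | _ :: l => (M.hom_comp_hom q _ _ _ _).trans (congrArg (M.hom q _) (iterMap_comp_iterMapTo q r φ ψ l))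

theorem iterMapTo_comp_iterMap (q : Fin n) {f : β → V} {g g' : β' → V} (r : β → β')
    (φ : ∀ b, f b ⟶ g (r b)) (ψ : ∀ b, g b ⟶ g' b) :
    ∀ l : List β, M.iterMapTo q r φ l ≫ M.iterMap q ψ (l.map r) =
      M.iterMapTo q r (fun b => φ b ≫ ψ (r b)) l
  | [] => Category.id_comp _
  | _ :: l => (M.hom_comp_hom q _ _ _ _).trans (congrArg (M.hom q _) (iterMapTo_comp_iterMap q r φ ψ l))

theorem iterMapTo_comp_iterChange {s r : Fin n} (h : s ≤ r) {f : β → V} {g : β' → V} (t : β → β')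
    (φ : ∀ b, f b ⟶ g (t b)) :
    ∀ l : List β, M.iterMapTo s t φ l ≫ M.iterChange s r h g (l.map t) =
      M.iterChange s r h f l ≫ M.iterMapTo r t φ l
  | [] => rfl
  | b :: l => M.hom_comp_change_step h (φ b) (iterMapTo_comp_iterChange h t φ l)

theorem iterMap_comp_iterChange {s r : Fin n} (h : s ≤ r) {f g : β → V} (φ : ∀ b, f b ⟶ g b) :
    ∀ l : List β, M.iterMap s φ l ≫ M.iterChange s r h g l =
      M.iterChange s r h f l ≫ M.iterMap r φ l
  | [] => rfl
  | b :: l => M.hom_comp_change_step h (φ b) (iterMap_comp_iterChange h φ l)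

theorem iterChange_trans {s r t : Fin n} (h : s ≤ r) (h' : r ≤ t) (f : β → V) :
    ∀ l : List β, M.iterChange s r h f l ≫ M.iterChange r t h' f l =
      M.iterChange s t (h.trans h') f l
  | [] => Category.id_comp _
  | b :: l => M.change_comp_change_step h h' (f b) (iterChange_trans h h' f l)

theorem iterChange_self (s : Fin n) (f : β → V) :
    ∀ l : List β, M.iterChange s s le_rfl f l = 𝟙 _
  | [] => rfl
  | b :: l => by
      have h {X : V} {c : X ⟶ X} (e : c = 𝟙 X) :
          M.hom s (𝟙 (f b)) c ≫ M.change s s le_rfl (f b) X = 𝟙 _ := by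
        rw [e, M.change_self, M.hom_id, Category.id_comp]
      exact h (iterChange_self s f l)

theorem iterUnit_comp_iterChange {s r : Fin n} (h : s ≤ r) {C : ℕ → V} (J : M.unit ⟶ C 1) :
    ∀ k : ℕ, M.iterUnit s J k ≫ M.iterChange s r h C (List.replicate k 1) = M.iterUnit r J k
  | 0 => Category.id_comp _
  | k + 1 => M.unit_comp_change_step h J (iterUnit_comp_iterChange h J k)

theorem iterChange_comp_iterAppend {s r : Fin n} (h : s ≤ r) (f : β → V) :
    ∀ l l' : List β, M.iterChange s r h f (l ++ l') ≫ M.iterAppend r f l l' =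
      M.iterAppend s f l l' ≫ M.hom s (M.iterChange s r h f l) (M.iterChange s r h f l') ≫
        M.change s r h (M.iter r f l) (M.iter r f l')
  | [], l' => by
      simp only [iterAppend, iterChange, List.nil_append]
      change M.iterChange s r h f l' ≫ (M.leftUnitor r (M.iter r f l')).inv =
        (M.leftUnitor s (M.iter s f l')).inv ≫ M.hom s (𝟙 M.unit) (M.iterChange s r h f l') ≫
          M.change s r h M.unit (M.iter r f l')
      rw [M.change_naturality, reassoc_of% M.leftUnitor_inv_change, M.leftUnitor_inv_naturality]
  | b :: l, l' => M.change_comp_append_step h (f b) (iterChange_comp_iterAppend h f l l')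

theorem iterChange_comp_iterEta {p s r : Fin n} (hps : p < s) (hsr : s ≤ r) (C D : ℕ → V) :
    ∀ L : List (List ℕ),
      M.hom p (M.iterChange s r hsr C (L.map List.length)) (M.iterChange s r hsr D L.flatten) ≫
          M.iterEta p r (hps.trans_le hsr) C D L =
        M.iterEta p s hps C D L ≫
          M.iterMap s (fun l => M.hom p (𝟙 (C l.length)) (M.iterChange s r hsr D l)) L ≫
          M.iterChange s r hsr (fun l => M.ob p (C l.length) (M.iter r D l)) L
  | [] => by
      simp only [iterEta, iterMap, iterChange, List.flatten_nil]
      erw [M.hom_id, Category.id_comp, Category.comp_id, Category.comp_id]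
  | l :: L => M.change_comp_eta_step hps hsr (C l.length)
      (M.iterChange_comp_iterAppend hsr D l L.flatten) (iterChange_comp_iterEta hps hsr C D L)

theorem change_comp_iterEta {p q r : Fin n} (hpq : p ≤ q) (hqr : q < r) (C D : ℕ → V) :
    ∀ L : List (List ℕ),
      M.change p q hpq (M.iter r C (L.map List.length)) (M.iter r D L.flatten) ≫
          M.iterEta q r hqr C D L =
        M.iterEta p r (hpq.trans_lt hqr) C D L ≫
          M.iterMap r (fun l => M.change p q hpq (C l.length) (M.iter r D l)) L
  | [] => by
      simp only [iterEta, iterMap]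
      erw [Category.comp_id]
      exact M.change_unit_left hpq M.unit
  | l :: L => M.change_comp_eta_step' hpq hqr (C l.length) (M.iterAppend r D l L.flatten)
      (change_comp_iterEta hpq hqr C D L)

end Iter

theorem domainChange_trans {p s q r p' r' : Fin n} (hpq : p ≤ q) (hsr : s ≤ r) (hqp : q ≤ p')
    (hrr : r ≤ r') (A : V) (C : ℕ → V) (l : List ℕ) :
    M.domainChange p s q r hpq hsr A C l ≫ M.domainChange q r p' r' hqp hrr A C l =
      M.domainChange p s p' r' (hpq.trans hqp) (hsr.trans hrr) A C l := by
  rw [domainChange, domainChange, domainChange, Category.assoc, ← reassoc_of% M.change_naturality,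
    M.change_trans, TensorData.hom_comp_hom_assoc, M.iterChange_trans, Category.comp_id]

theorem domainChange_self (p q : Fin n) (A : V) (C : ℕ → V) (l : List ℕ) :
    M.domainChange p q p q le_rfl le_rfl A C l = 𝟙 _ := by
  rw [domainChange, M.iterChange_self, M.change_self, M.hom_id, Category.id_comp]

theorem domainChange_naturality {p s q r : Fin n} (hpq : p ≤ q) (hsr : s ≤ r) {A B : V}
    {C D : ℕ → V} (g : A ⟶ B) (f : ∀ j, C j ⟶ D j) (l : List ℕ) :
    M.hom p g (M.iterMap s f l) ≫ M.domainChange p s q r hpq hsr B D l =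
      M.domainChange p s q r hpq hsr A C l ≫ M.hom q g (M.iterMap r f l) := by
  simp only [domainChange, Category.assoc, ← M.change_naturality, TensorData.hom_comp_hom_assoc,
    M.iterMap_comp_iterChange, Category.comp_id, Category.id_comp]

/-! ### Compositions for one pair of products -/

/-- The axioms of an operad for one pair of products, with compositions also for `k = 0`. -/
structure IsOperad (p q : Fin n) (hpq : p < q) {C : ℕ → V} (J : M.unit ⟶ C 1)
    (γ : ∀ (k j : ℕ) (l : List ℕ), l.length = k → l.sum = j →
      (M.ob p (C k) (M.iter q C l) ⟶ C j)) : Prop where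
  associativity {k j i : ℕ} (L : List (List ℕ)) (hk : L.length = k) (hj : L.flatten.length = j)
    (hi : L.flatten.sum = i) :
    M.hom p (γ k j (L.map List.length) ((List.length_map _).trans hk)
        (List.length_flatten.symm.trans hj)) (𝟙 (M.iter q C L.flatten)) ≫
      γ j i L.flatten hj hi =
    (M.assoc p (C k) (M.iter q C (L.map List.length)) (M.iter q C L.flatten)).hom ≫
      M.hom p (𝟙 (C k)) (M.iterEta p q hpq C C L) ≫
      M.hom p (𝟙 (C k)) (M.iterMapTo q List.sum (fun l => γ l.length l.sum l rfl rfl) L) ≫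
      γ k i (L.map List.sum) ((List.length_map _).trans hk) (List.sum_flatten.symm.trans hi)
  unit_right (k : ℕ) :
    (M.rightUnitor p (C k)).inv ≫ M.hom p (𝟙 (C k)) (M.iterUnit q J k) ≫
      γ k k (List.replicate k 1) List.length_replicate (by simp) = 𝟙 (C k)
  unit_left (k : ℕ) :
    (M.leftUnitor p (C k)).inv ≫ M.hom p J (M.rightUnitor q (C k)).inv ≫
      γ 1 k [k] rfl (by simp) = 𝟙 (C k)

namespace IsOperad

variable {M} {C : ℕ → V} {J : M.unit ⟶ C 1} {p q r s : Fin n}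

/-- For `k = 0` the map `iterUnit` is the identity of `I`, so the right unit axiom itself prescribes
this composition. Every comparison may therefore be confined to `k ≥ 1`. -/
theorem nil {hpq : p < q} {γ : ∀ (k j : ℕ) (l : List ℕ), l.length = k → l.sum = j →
      (M.ob p (C k) (M.iter q C l) ⟶ C j)} (H : M.IsOperad p q hpq J γ) {k j : ℕ}
    (hk : [].length = k) (hj : [].sum = j) :
    γ k j [] hk hj = (M.rightUnitor p (C k)).hom ≫ eqToHom (congrArg C (hk.symm.trans hj)) := by
  subst hk
  subst hj
  have h := H.unit_right 0
  rw [Iso.inv_comp_eq] at h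
  erw [M.hom_id, Category.id_comp] at h
  exact h

theorem change_right {hpr : p < r} {γ : ∀ (k j : ℕ) (l : List ℕ), l.length = k → l.sum = j →
      (M.ob p (C k) (M.iter r C l) ⟶ C j)} (H : M.IsOperad p r hpr J γ)
    (hps : p < s) (hsr : s ≤ r) :
    M.IsOperad p s hps J fun k j l hk hj =>
      M.hom p (𝟙 (C k)) (M.iterChange s r hsr C l) ≫ γ k j l hk hj where
  associativity {k j i} L hk hj hi := by
    -- The old associativity is precomposed with the changes in both layers.
    -- `iterChange_comp_iterEta` then turns `η^{pr}` into `η^{ps}`, leaving changes inside the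
    -- blocks and one across them.
    have h := M.hom p (M.hom p (𝟙 (C k)) (M.iterChange s r hsr C (L.map List.length)))
      (M.iterChange s r hsr C L.flatten) ≫= H.associativity L hk hj hi
    rw [reassoc_of% M.assoc_naturality, TensorData.hom_comp_hom_assoc,
      TensorData.hom_comp_hom_assoc, M.iterChange_comp_iterEta hps hsr] at h
    simp only [TensorData.hom_comp_hom_assoc, Category.id_comp, Category.comp_id,
      Category.assoc] at h ⊢
    rw [h, ← M.iterMap_comp_iterMapTo, Category.assoc, M.iterMapTo_comp_iterChange]
  unit_right k := by
    rw [TensorData.hom_comp_hom_assoc, M.iterUnit_comp_iterChange, Category.comp_id]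
    exact H.unit_right k
  unit_left k := by
    -- On a list with one entry `iterChange` is a single `change` into the unit, which the unitor
    -- absorbs.
    have h : (M.rightUnitor s (C k)).inv ≫ M.hom s (𝟙 (C k)) (𝟙 M.unit) ≫
        M.change s r hsr (C k) M.unit = (M.rightUnitor r (C k)).inv := by
      rw [M.hom_id, Category.id_comp, M.rightUnitor_inv_change]
    have h' {Z : V} (g : M.ob p (C 1) (M.ob r (C k) M.unit) ⟶ Z) :
        M.hom p J (M.rightUnitor s (C k)).inv ≫ M.hom p (𝟙 (C 1)) (M.hom s (𝟙 (C k)) (𝟙 M.unit) ≫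
          M.change s r hsr (C k) M.unit) ≫ g = M.hom p J (M.rightUnitor r (C k)).inv ≫ g := by
      rw [TensorData.hom_comp_hom_assoc, h, Category.comp_id]
    exact (congrArg _ (h' _)).trans (H.unit_left k)

theorem change_left {hqr : q < r} {γ : ∀ (k j : ℕ) (l : List ℕ), l.length = k → l.sum = j →
      (M.ob q (C k) (M.iter r C l) ⟶ C j)} (H : M.IsOperad q r hqr J γ) (hpq : p ≤ q) :
    M.IsOperad p r (hpq.trans_lt hqr) J fun k j l hk hj =>
      M.change p q hpq (C k) (M.iter r C l) ≫ γ k j l hk hj where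
  associativity {k j i} L hk hj hi := by
    have h := H.associativity L hk hj hi
    rw [← M.iterMap_comp_iterMapTo, TensorData.hom_comp_hom_assoc, Category.id_comp,
      ← Category.assoc (M.iterEta p r _ C C L), ← M.change_comp_iterEta hpq hqr C C L]
    exact M.change_comp_assoc_step hpq h
  unit_right k := by
    rw [reassoc_of% M.change_naturality, reassoc_of% M.rightUnitor_inv_change]
    exact H.unit_right k
  unit_left k := by
    have h := M.change_naturality hpq J (M.rightUnitor r (C k)).inv
    erw [reassoc_of% h, reassoc_of% M.leftUnitor_inv_change]
    exact H.unit_left k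

theorem change {hqr : q < r} {γ : ∀ (k j : ℕ) (l : List ℕ), l.length = k → l.sum = j →
      (M.ob q (C k) (M.iter r C l) ⟶ C j)} (H : M.IsOperad q r hqr J γ) (hps : p < s)
    (hpq : p ≤ q) (hsr : s ≤ r) :
    M.IsOperad p s hps J fun k j l hk hj =>
      M.domainChange p s q r hpq hsr (C k) C l ≫ γ k j l hk hj := by
  simp only [domainChange, Category.assoc]
  -- The order matters: the intermediate pair `(p, r)` satisfies `p ≤ q < r`, whereas `q < s` may
  -- fail for the pair `(q, s)`.
  exact (H.change_left hpq).change_right hps hsr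

end IsOperad

end IteratedMonoidal

namespace IteratedMonoidal

variable {n : ℕ} {V : Type u} [Category.{v} V] (M : IteratedMonoidal n V)

/-! ### Morphisms out of products of collections -/

section Collections

variable [HasCoproducts.{0} V]

theorem ι_descLeft (hM : M.PreservesCoproducts) (p : Fin n) {J : Type} (X : J → V) (Y : V) {Z : V}
    (φ : ∀ b, M.ob p (X b) Y ⟶ Z) (b : J) :
    M.hom p (Sigma.ι X b) (𝟙 Y) ≫ M.descLeft hM p X Y φ = φ b := by
  have := hM.left p Y J
  have h := Cofan.IsColimit.fac
    (isColimitOfHasCoproductOfPreservesColimit ((M.tensor p).flip.obj Y) X) φ b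
  simpa [TensorData.hom, descLeft] using h

theorem hom_ext_left (hM : M.PreservesCoproducts) (p : Fin n) {J : Type} (X : J → V) (Y : V)
    {Z : V} {f g : M.ob p (∐ X) Y ⟶ Z}
    (h : ∀ b, M.hom p (Sigma.ι X b) (𝟙 Y) ≫ f = M.hom p (Sigma.ι X b) (𝟙 Y) ≫ g) : f = g := by
  have := hM.left p Y J
  refine Cofan.IsColimit.hom_ext
    (isColimitOfHasCoproductOfPreservesColimit ((M.tensor p).flip.obj Y) X) f g fun b => ?_
  simpa [TensorData.hom] using h b

theorem colι_rfl (p q : Fin n) (B C : ℕ → V) {j : ℕ} (l : List ℕ) (hj : l.sum = j) :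
    M.colι p q B C l rfl hj =
      Sigma.ι (fun l : {l : List ℕ // l.sum = j} => M.ob p (B l.1.length) (M.iter q C l.1)) ⟨l, hj⟩ :=
  Category.id_comp _

theorem colι_comp_desc (p q : Fin n) (B C : ℕ → V) {j : ℕ} {Z : V}
    (φ : ∀ l : {l : List ℕ // l.sum = j}, M.ob p (B l.1.length) (M.iter q C l.1) ⟶ Z)
    (l : List ℕ) (hj : l.sum = j) :
    M.colι p q B C l rfl hj ≫ Sigma.desc φ = φ ⟨l, hj⟩ := by
  rw [colι_rfl]
  exact Sigma.ι_desc φ ⟨l, hj⟩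

theorem colTensor_hom_ext {p q : Fin n} {B C : ℕ → V} {j : ℕ} {Z : V}
    {f g : M.colTensor p q B C j ⟶ Z}
    (h : ∀ (l : List ℕ) (hj : l.sum = j),
      M.colι p q B C l rfl hj ≫ f = M.colι p q B C l rfl hj ≫ g) : f = g := by
  refine Sigma.hom_ext _ _ fun l => ?_
  have h' := h l.1 l.2
  rw [colι_rfl] at h'
  exact h'

theorem colTensor_hom_ext₂ (hM : M.PreservesCoproducts) {p q : Fin n} {B C D : ℕ → V} {i : ℕ}
    {Z : V} {f g : M.colTensor p q (M.colTensor p q B C) D i ⟶ Z}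
    (h : ∀ (L : List (List ℕ)) (hi : L.flatten.sum = i),
      M.hom p (M.colι p q B C (L.map List.length) rfl List.length_flatten.symm) (𝟙 _) ≫
          M.colι p q (M.colTensor p q B C) D L.flatten rfl hi ≫ f =
        M.hom p (M.colι p q B C (L.map List.length) rfl List.length_flatten.symm) (𝟙 _) ≫
          M.colι p q (M.colTensor p q B C) D L.flatten rfl hi ≫ g) : f = g := by
  refine M.colTensor_hom_ext fun l hi => M.hom_ext_left hM p _ _ ?_
  rintro ⟨l', hl'⟩
  -- A summand of the double product is a list `l` with prescribed block lengths `l'`, which is the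
  -- same as a list of blocks.
  obtain ⟨L, rfl, rfl⟩ : ∃ L : List (List ℕ), L.map List.length = l' ∧ L.flatten = l :=
    ⟨l'.splitLengths l, List.map_splitLengths_length _ _ hl'.le,
      List.flatten_splitLengths _ _ hl'.ge⟩
  have h' := h L hi
  rw [M.colι_rfl p q B C] at h'
  exact h'

theorem colι_comp_colTensorHom (p q : Fin n) {B B' C C' : ℕ → V} (f : ∀ j, B j ⟶ B' j)
    (g : ∀ j, C j ⟶ C' j) {k j : ℕ} (l : List ℕ) (hk : l.length = k) (hj : l.sum = j) :
    M.colι p q B C l hk hj ≫ M.colTensorHom p q f g j =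
      M.hom p (f k) (M.iterMap q g l) ≫ M.colι p q B' C' l hk hj := by
  subst hk
  rw [colι_rfl, colι_rfl]
  exact Sigma.ι_map _ _

theorem colι_comp_colAssoc (hM : M.PreservesCoproducts) (p q : Fin n) (hpq : p < q)
    (B C D : ℕ → V) {i : ℕ} (L : List (List ℕ)) (hi : L.flatten.sum = i) :
    M.hom p (M.colι p q B C (L.map List.length) rfl List.length_flatten.symm) (𝟙 _) ≫
        M.colι p q (M.colTensor p q B C) D L.flatten rfl hi ≫ M.colAssoc hM p q hpq B C D i =
      M.colAssocTerm p q hpq B C D L hi := by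
  -- With the block list as a variable, the transport in `colAssoc` disappears by substitution.
  -- Below, `h` says that cutting the concatenation of `L` at the lengths of its blocks returns `L`.
  have key (L' : List (List ℕ)) (hL : L' = L) (e) (hi' : L'.flatten.sum = i) :
      eqToHom e ≫ M.colAssocTerm p q hpq B C D L' hi' = M.colAssocTerm p q hpq B C D L hi := by
    subst hL
    simp
  have h : (L.map List.length).splitLengths L.flatten = L := by
    clear hi key
    induction L with
    | nil => rfl
    | cons l L ih => simp [ih]
  refine (congrArg (fun x => M.hom p (M.colι p q B C _ _ _) (𝟙 (M.iter q D L.flatten)) ≫ x)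
    (M.colι_comp_desc p q (M.colTensor p q B C) D _ L.flatten hi)).trans ?_
  rw [M.colι_rfl p q B C]
  exact (M.ι_descLeft hM p (fun l : {l : List ℕ // l.sum = L.flatten.length} =>
    M.ob p (B l.1.length) (M.iter q C l.1)) _ _ ⟨L.map List.length, List.length_flatten.symm⟩).trans
    (key _ h _ _)

/-- The map of collections out of the unit collection given by `J : I ⟶ C(1)`. -/
noncomputable def colUnitDesc {C : ℕ → V} (J : M.unit ⟶ C 1) : ∀ j, M.colUnit j ⟶ C j
  | 0 => (M.isInitial_colUnit 0 (by simp)).some.to _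
  | 1 => J
  | j + 2 => (M.isInitial_colUnit (j + 2) (by simp)).some.to _

theorem colUnit_hom_ext {C : ℕ → V} {f g : ∀ j, M.colUnit j ⟶ C j} (h : f 1 = g 1) : f = g := by
  funext j
  by_cases hj : j = 1
  · subst hj
    exact h
  · exact (M.isInitial_colUnit j hj).some.hom_ext _ _

theorem iterUnit_comp_iterMap (q : Fin n) {C : ℕ → V} (f : ∀ j, M.colUnit j ⟶ C j) :
    ∀ k : ℕ, M.iterUnit q (C := M.colUnit) (𝟙 M.unit) k ≫
      M.iterMap q f (List.replicate k 1) = M.iterUnit q (f 1) k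
  | 0 => Category.id_comp _
  | k + 1 => by
      have ih := iterUnit_comp_iterMap q f k
      have h {X Y : V} (u : M.unit ⟶ X) (c : X ⟶ Y) (J : M.unit ⟶ C 1) :
          ((M.leftUnitor q M.unit).inv ≫ M.hom q (𝟙 M.unit) u) ≫ M.hom q J c =
            (M.leftUnitor q M.unit).inv ≫ M.hom q J (u ≫ c) := by
        simp
      exact (h _ _ _).trans (congrArg (fun x => _ ≫ M.hom q (f 1) x) ih)

section Axioms

variable (hM : M.PreservesCoproducts) {p q : Fin n} (hpq : p < q) {C : ℕ → V}
  (one : ∀ j, M.colUnit j ⟶ C j) (mul : ∀ j, M.colTensor p q C C j ⟶ C j)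

/-- Both sides are restricted to the summand of a block list `L` (`key` and `key'`). These
restrictions determine the maps because `- ⊗_p Y` preserves coproducts. -/
theorem mul_assoc_iff (i : ℕ) :
    M.colTensorHom p q mul (fun k => 𝟙 (C k)) i ≫ mul i =
        M.colAssoc hM p q hpq C C C i ≫ M.colTensorHom p q (fun k => 𝟙 (C k)) mul i ≫ mul i ↔
      ∀ (L : List (List ℕ)) (hi : L.flatten.sum = i),
        M.hom p (M.colι p q C C (L.map List.length) rfl List.length_flatten.symm ≫ mul _) (𝟙 _) ≫
            M.colι p q C C L.flatten rfl hi ≫ mul i =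
          (M.assoc p (C (L.map List.length).length) (M.iter q C (L.map List.length))
              (M.iter q C L.flatten)).hom ≫
            M.hom p (𝟙 _) (M.iterEta p q hpq C C L) ≫
            M.hom p (𝟙 _) (M.iterMapTo q List.sum (fun l => M.colι p q C C l rfl rfl ≫ mul _) L) ≫
            M.colι p q C C (L.map List.sum) (by simp) (List.sum_flatten.symm.trans hi) ≫ mul i := by
  have key (L : List (List ℕ)) (hi : L.flatten.sum = i) :
      M.hom p (M.colι p q C C (L.map List.length) rfl List.length_flatten.symm) (𝟙 _) ≫
        M.colι p q (M.colTensor p q C C) C L.flatten rfl hi ≫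
        M.colTensorHom p q mul (fun k => 𝟙 (C k)) i ≫ mul i =
      M.hom p (M.colι p q C C (L.map List.length) rfl List.length_flatten.symm ≫ mul _) (𝟙 _) ≫
            M.colι p q C C L.flatten rfl hi ≫ mul i := by
    rw [reassoc_of% M.colι_comp_colTensorHom, M.iterMap_id, TensorData.hom_comp_hom_assoc,
      Category.comp_id]
  have key' (L : List (List ℕ)) (hi : L.flatten.sum = i) :
      M.hom p (M.colι p q C C (L.map List.length) rfl List.length_flatten.symm) (𝟙 _) ≫
        M.colι p q (M.colTensor p q C C) C L.flatten rfl hi ≫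
        M.colAssoc hM p q hpq C C C i ≫ M.colTensorHom p q (fun k => 𝟙 (C k)) mul i ≫ mul i =
      (M.assoc p (C (L.map List.length).length) (M.iter q C (L.map List.length))
              (M.iter q C L.flatten)).hom ≫
            M.hom p (𝟙 _) (M.iterEta p q hpq C C L) ≫
            M.hom p (𝟙 _) (M.iterMapTo q List.sum (fun l => M.colι p q C C l rfl rfl ≫ mul _) L) ≫
            M.colι p q C C (L.map List.sum) (by simp) (List.sum_flatten.symm.trans hi) ≫
            mul i := by
    rw [reassoc_of% M.colι_comp_colAssoc, colAssocTerm]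
    simp only [Category.assoc]
    rw [reassoc_of% M.colι_comp_colTensorHom, M.hom_comp_hom_assoc p (𝟙 _) (𝟙 _) (M.iterMapTo _ _ _ _),
      Category.comp_id, M.iterMapTo_comp_iterMap]
  constructor
  · intro h L hi
    rw [← key, ← key', h]
  · intro h
    refine M.colTensor_hom_ext₂ hM fun L hi => ?_
    rw [key, key', h]

/-- The inverse of the unitor is the explicit inclusion `colLeftUnitorInv`. Precomposing with it
leaves an equation of endomorphisms of `C j`, in which the unitor itself no longer occurs. -/
theorem one_mul_iff (j : ℕ) :
    M.colTensorHom p q one (fun k => 𝟙 (C k)) j ≫ mul j = (M.colLeftUnitor hM p q C j).hom ↔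
      (M.leftUnitor p (C j)).inv ≫ M.hom p (one 1) (M.rightUnitor q (C j)).inv ≫
        M.colι p q C C (k := 1) [j] rfl (by simp) ≫ mul j = 𝟙 (C j) := by
  have h : (M.colLeftUnitor hM p q C j).inv ≫ M.colTensorHom p q one (fun k => 𝟙 (C k)) j ≫ mul j =
      (M.leftUnitor p (C j)).inv ≫ M.hom p (one 1) (M.rightUnitor q (C j)).inv ≫
        M.colι p q C C (k := 1) [j] rfl (by simp) ≫ mul j := by
    change M.colLeftUnitorInv p q C j ≫ _ = _
    rw [colLeftUnitorInv]
    have h₁ := M.colι_comp_colTensorHom p q one (fun k => 𝟙 (C k)) (k := 1) [j] rfl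
      (by simp : [j].sum = j)
    rw [M.iterMap_id] at h₁
    have h₂ {X Y Z W : V} (x : M.unit ⟶ X) (y : C j ⟶ Y) (g : M.ob p M.unit Y ⟶ Z)
        (t : Z ⟶ W) (g' : M.ob p X Y ⟶ W) (m : W ⟶ C j)
        (e : g ≫ t = M.hom p x (𝟙 Y) ≫ g') :
        ((M.leftUnitor p (C j)).inv ≫ M.hom p (𝟙 M.unit) y ≫ g) ≫ t ≫ m =
          (M.leftUnitor p (C j)).inv ≫ M.hom p x y ≫ g' ≫ m := by
      simp only [Category.assoc, reassoc_of% e, TensorData.hom_comp_hom_assoc, Category.id_comp,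
        Category.comp_id]
    exact h₂ (one 1) (M.rightUnitor q (C j)).inv _ _ _ _ h₁
  rw [← h, Iso.inv_comp_eq, Category.comp_id]

theorem mul_one_iff (j : ℕ) :
    M.colTensorHom p q (fun k => 𝟙 (C k)) one j ≫ mul j = (M.colRightUnitor hM p q C j).hom ↔
      (M.rightUnitor p (C j)).inv ≫ M.hom p (𝟙 (C j)) (M.iterUnit q (one 1) j) ≫
        M.colι p q C C (List.replicate j 1) List.length_replicate (by simp) ≫ mul j = 𝟙 (C j) := by
  have h : (M.colRightUnitor hM p q C j).inv ≫
      M.colTensorHom p q (fun k => 𝟙 (C k)) one j ≫ mul j =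
      (M.rightUnitor p (C j)).inv ≫ M.hom p (𝟙 (C j)) (M.iterUnit q (one 1) j) ≫
        M.colι p q C C (List.replicate j 1) List.length_replicate (by simp) ≫ mul j := by
    change M.colRightUnitorInv p q C j ≫ _ = _
    rw [colRightUnitorInv]
    simp only [Category.assoc]
    rw [reassoc_of% M.colι_comp_colTensorHom, TensorData.hom_comp_hom_assoc, Category.comp_id,
      M.iterUnit_comp_iterMap]
  rw [← h, Iso.inv_comp_eq, Category.comp_id]

end Axioms

end Collections

/-! ### Monoids of collections and operads for one pair of products -/

namespace ColMonoid

variable {M} [HasCoproducts.{0} V] {hM : M.PreservesCoproducts} {p q : Fin n} {hpq : p < q}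
  {C D : ℕ → V}

theorem isOperad (N : M.ColMonoid hM p q hpq C) :
    M.IsOperad p q hpq (N.one 1) fun _ _ l hk hj => N.comp l hk hj where
  associativity {k j i} L hk hj hi := by
    obtain rfl : (L.map List.length).length = k := (List.length_map _).trans hk
    subst hj
    exact (M.mul_assoc_iff hM hpq N.mul i).mp (N.mul_assoc i) L hi
  unit_right k := (M.mul_one_iff hM N.one N.mul k).mp (N.mul_one k)
  unit_left k := (M.one_mul_iff hM N.one N.mul k).mp (N.one_mul k)

/-- Outside degree one the unit collection is initial, and the summand with `k = 0` is settled by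
`IsOperad.nil`. -/
theorem ext_comp {N N' : M.ColMonoid hM p q hpq C} (h : N.one 1 = N'.one 1)
    (h' : ∀ (k j : ℕ) (l : List ℕ) (hk : l.length = k) (hj : l.sum = j), 1 ≤ k →
      N.comp l hk hj = N'.comp l hk hj) : N = N' := by
  have h₁ : N.one = N'.one := M.colUnit_hom_ext h
  have h₂ : N.mul = N'.mul := by
    funext j
    refine M.colTensor_hom_ext fun l hj => ?_
    cases l with
    | nil => exact (N.isOperad.nil rfl hj).trans (N'.isOperad.nil rfl hj).symm
    | cons a l => exact h' _ j (a :: l) rfl hj (by simp)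
  cases N
  cases N'
  simp only at h₁ h₂
  subst h₁
  subst h₂
  rfl

end ColMonoid

namespace IsOperad

variable {M} [HasCoproducts.{0} V] {p q : Fin n} {hpq : p < q} {C : ℕ → V} {J : M.unit ⟶ C 1}
  {γ : ∀ (k j : ℕ) (l : List ℕ), l.length = k → l.sum = j → (M.ob p (C k) (M.iter q C l) ⟶ C j)}

/-- The converse of `ColMonoid.isOperad`: the universal property of the coproduct assembles the
compositions into one multiplication. -/
theorem exists_colMonoid (H : M.IsOperad p q hpq J γ) (hM : M.PreservesCoproducts) :
    ∃ N : M.ColMonoid hM p q hpq C, N.one 1 = J ∧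
      ∀ (k j : ℕ) (l : List ℕ) (hk : l.length = k) (hj : l.sum = j),
        N.comp l hk hj = γ k j l hk hj := by
  let mul (j : ℕ) : M.colTensor p q C C j ⟶ C j := Sigma.desc fun l => γ _ j l.1 rfl l.2
  have hmul {k j : ℕ} (l : List ℕ) (hk : l.length = k) (hj : l.sum = j) :
      M.colι p q C C l hk hj ≫ mul j = γ k j l hk hj := by
    subst hk
    exact M.colι_comp_desc p q C C _ l hj
  refine ⟨⟨M.colUnitDesc J, mul, fun i => (M.mul_assoc_iff hM hpq mul i).mpr fun L hi => ?_,
    fun j => (M.one_mul_iff hM _ mul j).mpr ?_, fun j => (M.mul_one_iff hM _ mul j).mpr ?_⟩,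
    rfl, fun k j l hk hj => hmul l hk hj⟩
  · simp only [hmul]
    exact H.associativity L (by simp) rfl hi
  · have h := H.unit_left j
    rw [← hmul] at h
    exact h
  · have h := H.unit_right j
    rw [← hmul] at h
    exact h

end IsOperad

end IteratedMonoidal

namespace IteratedMonoidal

variable {n : ℕ} {V : Type u} [Category.{v} V] {M : IteratedMonoidal n V}

/-! ### Expanded operads, one pair of products at a time -/

namespace OperadData

variable {m : ℕ} {C : ℕ → V}

theorem gam_eq_comp (O : M.OperadData m C) {p q : Fin n} (hpq : p < q) (hq : q.val < m) {k j : ℕ}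
    (l : List ℕ) (hpos : 1 ≤ k) (hk : l.length = k) (hj : l.sum = j) :
    O.gam p q hpq hq l hk hj = O.comp p q hpq hq l hpos hk hj := by
  cases l with
  | nil => subst hk; simp at hpos
  | cons a l => rfl

end OperadData

namespace ExpandedOperad

variable {m : ℕ} {C D : ℕ → V}

/-- Only associativity for the empty block list is new, and there it is the triangle identity for `C
0`. -/
theorem isOperad (O : M.ExpandedOperad m C) {p q : Fin n} (hpq : p < q) (hq : q.val < m) :
    M.IsOperad p q hpq O.unit fun _ _ l hk hj => O.gam p q hpq hq l hk hj where
  associativity {k j i} L hk hj hi := by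
    cases L with
    | nil =>
      subst hk
      subst hj
      subst hi
      have h := M.triangle p (C 0) M.unit
      have h' : M.hom p ((M.rightUnitor p (C 0)).hom ≫ 𝟙 (C 0)) (𝟙 M.unit) ≫
          (M.rightUnitor p (C 0)).hom ≫ 𝟙 (C 0) =
          (M.assoc p (C 0) M.unit M.unit).hom ≫
            M.hom p (𝟙 (C 0)) (M.leftUnitor p M.unit).hom ≫
            M.hom p (𝟙 (C 0)) (𝟙 M.unit) ≫ (M.rightUnitor p (C 0)).hom ≫ 𝟙 (C 0) := by
        rw [M.hom_id, Category.id_comp, reassoc_of% h, Category.comp_id]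
      exact h'
    | cons l L => exact O.associativity p q hpq hq (l :: L) (by simp [← hk]) hk hj hi
  unit_right := O.unit_right p q hpq hq
  unit_left := O.unit_left p q hpq hq

theorem ext_comp {O O' : M.ExpandedOperad m C} (h : O.unit = O'.unit)
    (h' : ∀ (p q : Fin n) (hpq : p < q) (hq : q.val < m) (k j : ℕ) (l : List ℕ) (hpos : 1 ≤ k)
      (hk : l.length = k) (hj : l.sum = j),
      O.comp p q hpq hq l hpos hk hj = O'.comp p q hpq hq l hpos hk hj) : O = O' := by
  have e : O.toOperadData = O'.toOperadData := by
    obtain ⟨⟨J, γ⟩, _, _, _⟩ := O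
    obtain ⟨⟨J', γ'⟩, _, _, _⟩ := O'
    obtain rfl : J = J' := h
    obtain rfl : @γ = @γ' := by
      funext p q hpq hq k j l hpos hk hj
      exact h' p q hpq hq k j l hpos hk hj
    rfl
  cases O
  cases O'
  subst e
  rfl

/-- The expanded operad structure given by operad structures for the single pairs of products. -/
def ofIsOperad (J : M.unit ⟶ C 1)
    (γ : ∀ (p q : Fin n), p < q → q.val < m → ∀ (k j : ℕ) (l : List ℕ), l.length = k →
      l.sum = j → (M.ob p (C k) (M.iter q C l) ⟶ C j))
    (H : ∀ (p q : Fin n) (hpq : p < q) (hq : q.val < m), M.IsOperad p q hpq J (γ p q hpq hq)) :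
    M.ExpandedOperad m C :=
  let O : M.OperadData m C :=
    { unit := J
      comp := fun p q hpq hq {k j} l _ hk hj => γ p q hpq hq k j l hk hj }
  -- Passing to `comp` forgets the value of `γ` at `k = 0`. The canonical map that `gam` puts there
  -- is the same one, by `IsOperad.nil`.
  have hO : (fun (p q : Fin n) (hpq : p < q) (hq : q.val < m) (k j : ℕ) (l : List ℕ)
      (hk : l.length = k) (hj : l.sum = j) => O.gam p q hpq hq l hk hj) = γ := by
    funext p q hpq hq k j l hk hj
    cases l with
    | nil => exact ((H p q hpq hq).nil hk hj).symm
    | cons a l => rfl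
  have hO' (p q : Fin n) (hpq : p < q) (hq : q.val < m) :
      M.IsOperad p q hpq J fun k j l hk hj => O.gam p q hpq hq l hk hj := by
    have h := H p q hpq hq
    rw [← hO] at h
    exact h
  { O with
    associativity := fun p q hpq hq _ _ _ L _ hk hj hi =>
      (hO' p q hpq hq).associativity L hk hj hi
    unit_right := fun p q hpq hq => (hO' p q hpq hq).unit_right
    unit_left := fun p q hpq hq => (hO' p q hpq hq).unit_left }

end ExpandedOperad

/-! ### The correspondence between expanded operads and monoids -/

section Agree

variable [HasCoproducts.{0} V] {hM : M.PreservesCoproducts} {m : ℕ} {hm : 2 ≤ m} {hn : m ≤ n}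
  {C D : ℕ → V}

theorem le_upper (hm : 2 ≤ m) (hn : m ≤ n) {q : Fin n} (hq : q.val < m) : q ≤ upper m hm hn :=
  Fin.le_def.mpr (Nat.le_sub_one_of_lt hq)

/-- Compatibility with the top pair `(m-1, m)` as target shows that the multiplication determines
every composition. -/
theorem Agree.comp_eq {O : M.ExpandedOperad m C} {N : M.CondensedOperad hM m hm hn C}
    (h : M.Agree O N) (hO : O.Compatible) (p q : Fin n) (hpq : p < q) (hq : q.val < m) (k j : ℕ)
    (l : List ℕ) (hpos : 1 ≤ k) (hk : l.length = k) (hj : l.sum = j) :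
    O.comp p q hpq hq l hpos hk hj =
      M.domainChange p q (lower m hm hn) (upper m hm hn) (le_lower hpq (le_upper hm hn hq))
        (le_upper hm hn hq) (C k) C l ≫ N.comp l hk hj := by
  rw [hO p q (lower m hm hn) (upper m hm hn) hpq (le_upper hm hn hq)
    (by simp only [lower, upper]; omega) (Nat.sub_one_lt_of_lt hm) k j l hpos hk hj, h.comp]

theorem existsUnique_agree (O : M.ExpandedOperad m C) :
    ∃! N : M.CondensedOperad hM m hm hn C, M.Agree O N := by
  obtain ⟨N, h₁, h₂⟩ := (O.isOperad (lower_lt_upper m hm hn)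
    (Nat.sub_one_lt_of_lt hm)).exists_colMonoid hM
  refine ⟨N, ⟨h₁.symm, fun k j l hpos hk hj => ?_⟩, fun N' h => ?_⟩
  · rw [h₂]
    exact (O.gam_eq_comp _ _ l hpos hk hj).symm
  · refine ColMonoid.ext_comp (h.unit.symm.trans h₁.symm) fun k j l hk hj hpos => ?_
    rw [h₂]
    exact (h.comp k j l hpos hk hj).symm.trans (O.gam_eq_comp _ _ l hpos hk hj).symm

theorem existsUnique_expandedOperad (N : M.CondensedOperad hM m hm hn C) :
    ∃! O : M.ExpandedOperad m C, O.Compatible ∧ M.Agree O N := by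
  let O : M.ExpandedOperad m C := ExpandedOperad.ofIsOperad (N.one 1)
    (fun p q hpq hq k j l hk hj =>
      M.domainChange p q (lower m hm hn) (upper m hm hn) (le_lower hpq (le_upper hm hn hq))
        (le_upper hm hn hq) (C k) C l ≫ N.comp l hk hj)
    (fun p q hpq hq => N.isOperad.change hpq _ _)
  refine ⟨O, ⟨fun p s q r hps hsr hqr hr k j l hpos hk hj => ?_, rfl,
    fun k j l hpos hk hj => ?_⟩, fun O' h => ExpandedOperad.ext_comp h.2.unit ?_⟩
  -- Both sides change the pair `(p, s)` into `(m-1, m)`, the right one by way of `(q, r)`, so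
  -- transitivity of `domainChange` gives compatibility.
  · change M.domainChange _ _ _ _ _ _ _ _ _ ≫ _ = _ ≫ M.domainChange _ _ _ _ _ _ _ _ _ ≫ _
    rw [reassoc_of% M.domainChange_trans]
  · change M.domainChange _ _ _ _ _ _ _ _ _ ≫ _ = _
    rw [M.domainChange_self, Category.id_comp]
  · intro p q hpq hq k j l hpos hk hj
    exact h.2.comp_eq h.1 p q hpq hq k j l hpos hk hj

theorem isHom_iff {O : M.ExpandedOperad m C} {O' : M.ExpandedOperad m D}
    {N : M.CondensedOperad hM m hm hn C} {N' : M.CondensedOperad hM m hm hn D}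
    {f : ∀ j, C j ⟶ D j} (hO : O.Compatible) (hO' : O'.Compatible) (h : M.Agree O N)
    (h' : M.Agree O' N') : O.IsHom O' f ↔ N.IsHom N' f := by
  constructor
  · intro H
    refine ⟨?_, fun j => M.colTensor_hom_ext fun l hj => ?_⟩
    · have e := M.colUnit_hom_ext (f := fun j => N.one j ≫ f j) (g := N'.one)
        ((congrArg (fun x => x ≫ f 1) h.unit).symm.trans (H.unit.trans h'.unit))
      exact congrFun e
    · rw [reassoc_of% M.colι_comp_colTensorHom]
      change _ = M.hom _ _ _ ≫ N'.comp l rfl hj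
      rw [← Category.assoc]
      change N.comp l rfl hj ≫ f j = _
      cases l with
      | nil =>
        subst hj
        -- For `k = 0` both multiplications are right unitors, and any map of collections commutes
        -- with them by naturality.
        have e : ((M.rightUnitor (lower m hm hn) (C 0)).hom ≫ 𝟙 (C 0)) ≫ f 0 =
            M.hom (lower m hm hn) (f 0) (𝟙 M.unit) ≫
              (M.rightUnitor (lower m hm hn) (D 0)).hom ≫ 𝟙 (D 0) := by
          rw [Category.comp_id, Category.comp_id, M.rightUnitor_naturality]
        exact (congrArg (fun x => x ≫ f 0) (N.isOperad.nil rfl rfl)).trans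
          (e.trans (congrArg (fun x => M.hom _ (f 0) (𝟙 M.unit) ≫ x)
            (N'.isOperad.nil rfl rfl)).symm)
      | cons a l =>
        have hpos : 1 ≤ (a :: l).length := by simp
        rw [← h.comp _ _ _ hpos, ← h'.comp _ _ _ hpos]
        exact H.comp _ _ _ _ _ _ _ hpos _ _
  · intro H
    refine ⟨(congrArg (fun x => x ≫ f 1) h.unit).trans ((H.one 1).trans h'.unit.symm), fun p q hpq hq k j l hpos hk hj => ?_⟩
    -- It is enough to know this for the top pair, since the other compositions differ from it by
    -- the natural maps `domainChange`.
    have e : N.comp l hk hj ≫ f j = M.hom _ (f k) (M.iterMap _ f l) ≫ N'.comp l hk hj := by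
      simp only [ColMonoid.comp, Category.assoc]
      rw [H.mul, reassoc_of% M.colι_comp_colTensorHom]
    rw [h.comp_eq hO, h'.comp_eq hO', Category.assoc, e, reassoc_of% M.domainChange_naturality]

theorem existsUnique_builtFrom {p s q r : Fin n} {hqr : q < r} (N : M.ColMonoid hM q r hqr C)
    (hps : p < s) (hpq : p ≤ q) (hsr : s ≤ r) :
    ∃! N' : M.ColMonoid hM p s hps C, N'.BuiltFrom hpq hsr N := by
  obtain ⟨N', h₁, h₂⟩ := (N.isOperad.change hps hpq hsr).exists_colMonoid hM
  refine ⟨N', ⟨congrFun (M.colUnit_hom_ext h₁), h₂⟩, fun N'' h => ?_⟩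
  refine ColMonoid.ext_comp ((h.one 1).trans h₁.symm) fun k j l hk hj _ => ?_
  rw [h.comp, h₂]

end Agree

end IteratedMonoidal
theorem mainTheorem3 {n : ℕ} {V : Type u} [Category.{v} V] (M : IteratedMonoidal n V)
    [HasCoproducts.{0} V] (hM : M.PreservesCoproducts) (m : ℕ) (hm : 2 ≤ m) (hn : m ≤ n) :
    -- every expanded operad is a monoid, with multiplication `γ^{m-1,m}`
    (∀ (C : ℕ → V) (O : M.ExpandedOperad m C),
      ∃! N : M.CondensedOperad hM m hm hn C, M.Agree O N) ∧
    -- every monoid arises, from exactly one expanded operad whose `γ^{pq}` are compatible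
    (∀ (C : ℕ → V) (N : M.CondensedOperad hM m hm hn C),
      ∃! O : M.ExpandedOperad m C, O.Compatible ∧ M.Agree O N) ∧
    -- under this correspondence the morphisms are the same
    (∀ (C D : ℕ → V) (O : M.ExpandedOperad m C) (O' : M.ExpandedOperad m D)
      (N : M.CondensedOperad hM m hm hn C) (N' : M.CondensedOperad hM m hm hn D)
      (f : ∀ j, C j ⟶ D j), O.Compatible → O'.Compatible → M.Agree O N → M.Agree O' N' →
        (O.IsHom O' f ↔ N.IsHom N' f)) ∧
    -- a monoid for `⊗^{m-1,m}` gives one for each `⊗^{ps}` with `p < s ≤ m`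
    (∀ (C : ℕ → V) (N : M.CondensedOperad hM m hm hn C) (p s : Fin n) (hps : p < s)
      (hs : s ≤ IteratedMonoidal.upper m hm hn),
      ∃! N' : M.ColMonoid hM p s hps C, N'.BuiltFrom (IteratedMonoidal.le_lower hps hs) hs N) ∧
    -- in particular, an `m`-fold operad is an `(m - 1)`-fold operad
    (∀ (h3 : 2 ≤ m - 1) (C : ℕ → V) (N : M.CondensedOperad hM m hm hn C),
      ∃! N' : M.CondensedOperad hM (m - 1) h3 ((Nat.sub_le m 1).trans hn) C,
        N'.BuiltFrom (Fin.mk_le_mk.mpr (Nat.sub_le_sub_right (Nat.sub_le m 1) 2))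
          (Fin.mk_le_mk.mpr (Nat.sub_le_sub_right (Nat.sub_le m 1) 1)) N) := by

  exact ⟨fun _ O => IteratedMonoidal.existsUnique_agree O,
    fun _ N => IteratedMonoidal.existsUnique_expandedOperad N,
    fun _ _ _ _ _ _ _ hO hO' h h' => IteratedMonoidal.isHom_iff hO hO' h h',
    fun _ N _ _ hps _ => IteratedMonoidal.existsUnique_builtFrom N hps _ _,
    fun h3 _ N => IteratedMonoidal.existsUnique_builtFrom N
      (IteratedMonoidal.lower_lt_upper (m - 1) h3 _) _ _⟩
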